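/- A Boolean network (BN) on $[n]=\{1,\dots,n\}$ is a map $f:\{0,1\}^n\to\{0,1\}^n$. Its signed interaction digraph has vertex set $[n]$ and a positive (resp. negative) arc from $j$ to $i$ whenever there is $x\in\{0,1\}^n$ with $x_j=0$ such that changing $x_j$ to $1$ strictly increases (resp. decreases) $f_i$; the sign of a cycle (with no repeated vertex; loops are cycles) is the product of the signs of its arcs. For $i\in[n]$ let $f^i(x)$ be obtained from $x$ by replacing $x_i$ by $f_i(x)$, and for a word $w=i_1\cdots i_\ell$ over $[n]$ let $f^w=f^{i_\ell}\circ\cdots\circ f^{i_1}$. The word $w$ synchronizes $f$ if $f^w$ is a constant function, and $f$ is synchronizing if some word synchronizes it. Let $\mathcal F^+(n)$ be the set of synchronizing BNs on $[n]$ whose signed interaction digraphs have no negative cycles. For every $n\ge 0$, a word over $[n]$ synchronizes every member of $\mathcal F^+(n)$ if and only if it is $n$-complete, that is, contains every permutation of $[n]$ as a (not necessarily contiguous) subsequence. Moreover, for every $n$, words synchronizing every member of $\mathcal F^+(n)$ exist, and their minimum length $\ell^+(n)$ satisfies $$\ell^+(n)=n^2-o(n^2)\qquad (n\to\infty),$$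 i.e. $\lim_{n\to\infty}\bigl(n^2-\ell^+(n)\bigr)/n^2=0$. -/

import Mathlib

/-- A signed digraph on the vertex set `V`: `G.Arc j i s` says that there is an arc from `j` to `i`
of sign `s`, where the group `ℤˣ` is `{1, -1}`.  Loops are allowed, and so is the presence of both
a positive and a negative arc from one vertex to another. -/
structure SignedDigraph (V : Type) where
  Arc : V → V → ℤˣ → Prop

namespace SignedDigraph

/-- A cycle of `G` of length `k + 1 ≥ 1`: pairwise distinct vertices `v 0, …, v k` and, for every
`t`, an arc of sign `s t` from `v t` to its cyclic successor (addition in `Fin (k + 1)` is modulo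
`k + 1`).  A loop is a cycle of length one. -/
structure Cycle {V : Type} (G : SignedDigraph V) where
  k : ℕ
  v : Fin (k + 1) → V
  s : Fin (k + 1) → ℤˣ
  injective_v : Function.Injective v
  arc : ∀ t, G.Arc (v t) (v (t + 1)) (s t)

/-- The sign of a cycle is the product of the signs of its arcs. -/
def Cycle.sign {V : Type} {G : SignedDigraph V} (C : G.Cycle) : ℤˣ := ∏ t, C.s t

/-- `G` has no negative cycles. -/
def NoNegativeCycles {V : Type} (G : SignedDigraph V) : Prop :=
  ∀ C : G.Cycle, C.sign ≠ -1

end SignedDigraph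

/-- A Boolean network with component set `V`. -/
abbrev BooleanNetwork (V : Type) : Type := (V → Bool) → (V → Bool)

namespace BooleanNetwork

/-- The signed interaction digraph of `f`: there is a positive (negative) arc from `j` to `i` if,
for some configuration `x` with `x j = 0`, switching component `j` from `0` to `1` strictly
increases (decreases) `f_i`. -/
def interactionDigraph {V : Type} [DecidableEq V] (f : BooleanNetwork V) : SignedDigraph V where
  Arc j i s := ∃ x : V → Bool, x j = false ∧
    ((s = 1 ∧ f x i < f (Function.update x j true) i) ∨
      (s = -1 ∧ f (Function.update x j true) i < f x i))

/-- The action `f^i` of the letter `i`: update component `i` only. -/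
def act {V : Type} [DecidableEq V] (f : BooleanNetwork V) (i : V) (x : V → Bool) : V → Bool :=
  Function.update x i (f x i)

/-- The action `f^w` of the word `w = i₁, …, i_ℓ`: first `f^{i₁}`, then `f^{i₂}`, and so on. -/
def actWord {V : Type} [DecidableEq V] (f : BooleanNetwork V) (w : List V) (x : V → Bool) :
    V → Bool :=
  w.foldl (fun y i => f.act i y) x

/-- The word `w` synchronizes `f` if `f^w` is a constant function. -/
def SynchronizedBy {V : Type} [DecidableEq V] (f : BooleanNetwork V) (w : List V) : Prop :=
  ∃ c : V → Bool, ∀ x : V → Bool, f.actWord w x = c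

/-- `f` is synchronizing if it admits a synchronizing word. -/
def IsSynchronizing {V : Type} [DecidableEq V] (f : BooleanNetwork V) : Prop :=
  ∃ w : List V, f.SynchronizedBy w

/-- The set `F⁺(n)` of synchronizing Boolean networks with component set `[n]` whose signed
interaction digraphs have no negative cycles. -/
def FPlus (n : ℕ) : Set (BooleanNetwork (Fin n)) :=
  {f | f.IsSynchronizing ∧ f.interactionDigraph.NoNegativeCycles}

/-- The word `w` synchronizes every member of the set `F`. -/
def SynchronizesSet {V : Type} [DecidableEq V] (w : List V) (F : Set (BooleanNetwork V)) : Prop :=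
  ∀ f ∈ F, f.SynchronizedBy w

/-- The lengths of the words over `[n]` that synchronize every member of `F⁺(n)`. -/
def syncLengths (n : ℕ) : Set ℕ :=
  {m | ∃ w : List (Fin n), w.length = m ∧ SynchronizesSet w (FPlus n)}

/-- `ℓ⁺(n)`, the minimum length of a word synchronizing every member of `F⁺(n)`. -/
noncomputable def ellPlus (n : ℕ) : ℕ := sInf (syncLengths n)

/-- A word over `[n]` is `n`-complete if it contains every permutation of `[n]`, written as the word
`σ(1), …, σ(n)`, as a (not necessarily contiguous) subsequence. -/
def IsComplete {n : ℕ} (w : List (Fin n)) : Prop :=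
  ∀ σ : Equiv.Perm (Fin n), (List.ofFn σ).Sublist w

end BooleanNetwork

/-! Necessity: given a permutation `σ`, let each component copy its predecessor along `σ`, the first
being constantly false. The all-false configuration is fixed, while from the all-true one falsehood
reaches the end only after updates in the order of `σ`. A synchronizing word therefore contains `σ`.

Sufficiency: settle the strongly connected components in topological order. Without negative cycles
a component becomes monotone after switching some coordinates (Harary), once its predecessors are
frozen. Climbing from the bottom reaches a fixed point `p`, descending from the top a fixed point
`q`, each by updating a component at most once. Synchronizability forces `p = q`, so the two lists
of updates partition the component. By monotonicity, extra updates do no harm. Concatenation gives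
one duplicate-free list such that every word containing it synchronizes (`exists_settles`), and a
complete word contains every such list.

Length: `n` copies of an enumeration give `n ^ 2`. For the lower bound, cut a word of length at most
`(1 - δ) * n ^ 2` into cells. If intervals covering all cells carry distinct letters, each absent
from its interval, then these letters in a suitable order are not a subsequence
(`exists_nodup_not_sublist`). Such intervals are first found fractionally: the maximal runs of cells
without a letter share a total weight of at most 1 per letter, and Cauchy–Schwarz shows that every
cell is covered by weight above 1. Within a window of cells, interval covering has no integrality
gap; multiplicative weights combine the windows so that no letter is overloaded; Hall's theorem then
makes the letters distinct. -/

namespace BooleanNetwork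

/-! ### Path networks and the necessity of completeness. -/

section Action

variable {V : Type} [DecidableEq V] (f : BooleanNetwork V)

@[simp] theorem actWord_nil (x : V → Bool) : f.actWord [] x = x := rfl

theorem actWord_cons (i : V) (w : List V) (x : V → Bool) :
    f.actWord (i :: w) x = f.actWord w (f.act i x) := rfl

theorem actWord_append (u w : List V) (x : V → Bool) :
    f.actWord (u ++ w) x = f.actWord w (f.actWord u x) := by
  simp [actWord, List.foldl_append]

theorem actWord_concat (w : List V) (i : V) (x : V → Bool) :
    f.actWord (w ++ [i]) x = f.act i (f.actWord w x) := by
  simp [actWord]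

end Action

/-- The network whose components copy each other along the enumeration `σ`, the first one being
constantly `false`. -/
def pathNetwork {n : ℕ} (σ : Equiv.Perm (Fin n)) : BooleanNetwork (Fin n) := fun x i =>
  if (σ.symm i).val = 0 then false
  else x (σ ⟨(σ.symm i).val - 1, lt_of_le_of_lt (Nat.sub_le _ _) (σ.symm i).isLt⟩)

theorem pathNetwork_zero {n : ℕ} (σ : Equiv.Perm (Fin n)) (x : Fin n → Bool) (h : 0 < n) :
    pathNetwork σ x (σ ⟨0, h⟩) = false := by
  simp [pathNetwork]

theorem pathNetwork_succ {n : ℕ} (σ : Equiv.Perm (Fin n)) (x : Fin n → Bool) (k : ℕ)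
    (h : k + 1 < n) :
    pathNetwork σ x (σ ⟨k + 1, h⟩) = x (σ ⟨k, Nat.lt_of_succ_lt h⟩) := by
  simp [pathNetwork]

theorem take_ofFn_succ {n : ℕ} (σ : Equiv.Perm (Fin n)) (k : ℕ) (h : k < n) :
    (List.ofFn σ).take (k + 1) = (List.ofFn σ).take k ++ [σ ⟨k, h⟩] := by
  rw [List.take_add_one, List.getElem?_ofFn]
  simp [h]

theorem actWord_pathNetwork_take {n : ℕ} (σ : Equiv.Perm (Fin n)) (x : Fin n → Bool) (k : ℕ)
    (hk : k ≤ n) (j : Fin n) (hj : j.val < k) :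
    (pathNetwork σ).actWord ((List.ofFn σ).take k) x (σ j) = false := by
  induction k generalizing j with
  | zero => omega
  | succ k ih =>
    rw [take_ofFn_succ σ k hk, actWord_concat, act]
    by_cases hjk : j.val = k
    · obtain rfl : j = ⟨k, hk⟩ := Fin.ext hjk
      rw [Function.update_self]
      cases k with
      | zero => exact pathNetwork_zero σ _ _
      | succ k =>
        rw [pathNetwork_succ]
        exact ih (by omega) _ (by simp)
    · rw [Function.update_of_ne]
      · exact ih (by omega) j (by omega)
      · intro h
        exact hjk (by have := σ.injective h; simp [this])

theorem pathNetwork_isSynchronizing {n : ℕ} (σ : Equiv.Perm (Fin n)) :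
    (pathNetwork σ).IsSynchronizing := by
  refine ⟨List.ofFn σ, fun _ => false, fun x => funext fun i => ?_⟩
  have h := actWord_pathNetwork_take σ x n le_rfl (σ.symm i) (Fin.isLt _)
  rwa [List.take_of_length_le (by simp), Equiv.apply_symm_apply] at h

theorem pathNetwork_mono {n : ℕ} (σ : Equiv.Perm (Fin n)) : Monotone (pathNetwork σ) := by
  intro x y h i
  unfold pathNetwork
  split_ifs
  · exact le_rfl
  · exact h _

theorem noNegativeCycles_of_monotone {V : Type} [DecidableEq V] {f : BooleanNetwork V}
    (hf : Monotone f) : f.interactionDigraph.NoNegativeCycles := by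
  intro C
  have h : ∀ t, C.s t = 1 := by
    intro t
    obtain ⟨x, hx, ⟨h, -⟩ | ⟨-, h⟩⟩ := C.arc t
    · exact h
    · refine absurd h (not_lt_of_ge (hf ?_ _))
      intro i
      by_cases hi : i = C.v t
      · subst hi; simp [hx]
      · simp [Function.update_of_ne hi]
  simp [SignedDigraph.Cycle.sign, h]

theorem pathNetwork_mem_FPlus {n : ℕ} (σ : Equiv.Perm (Fin n)) : pathNetwork σ ∈ FPlus n :=
  ⟨pathNetwork_isSynchronizing σ, noNegativeCycles_of_monotone (pathNetwork_mono σ)⟩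

theorem actWord_pathNetwork_false {n : ℕ} (σ : Equiv.Perm (Fin n)) (w : List (Fin n)) :
    (pathNetwork σ).actWord w (fun _ => false) = fun _ => false := by
  induction w with
  | nil => rfl
  | cons i w ih =>
    rw [actWord_cons]
    have : (pathNetwork σ).act i (fun _ => false) = fun _ => false := by
      simp [act, pathNetwork]
    rw [this, ih]

/-- Reading the word backwards, the last update of `σ k` must have found its predecessor along `σ`
already false; this locates the letters of the prefix from right to left. -/
theorem take_sublist_of_actWord_pathNetwork {n : ℕ} (σ : Equiv.Perm (Fin n)) (w : List (Fin n))
    (k : Fin n) (h : (pathNetwork σ).actWord w (fun _ => true) (σ k) = false) :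
    ((List.ofFn σ).take (k + 1)).Sublist w := by
  induction w using List.reverseRecOn generalizing k with
  | nil => simp at h
  | append_singleton w i ih =>
    rw [actWord_concat, act] at h
    by_cases hi : σ k = i
    · subst hi
      rw [Function.update_self] at h
      rw [take_ofFn_succ σ k k.isLt]
      refine List.Sublist.append ?_ (List.Sublist.refl _)
      obtain ⟨k, hk⟩ := k
      cases k with
      | zero => simp
      | succ k =>
        rw [pathNetwork_succ] at h
        exact ih _ h
    · rw [Function.update_of_ne hi] at h
      exact (ih k h).trans (List.sublist_append_left _ _)

theorem isComplete_of_synchronizesSet {n : ℕ} {w : List (Fin n)}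
    (h : SynchronizesSet w (FPlus n)) : IsComplete w := by
  intro σ
  cases n with
  | zero => simp
  | succ n =>
    obtain ⟨c, hc⟩ := h _ (pathNetwork_mem_FPlus σ)
    have h₁ := hc (fun _ => true)
    rw [← hc (fun _ => false), actWord_pathNetwork_false] at h₁
    have := take_sublist_of_actWord_pathNetwork σ w (Fin.last n) (congrFun h₁ _)
    rwa [List.take_of_length_le (by simp)] at this

/-! ### A complete word of quadratic length. -/

theorem sublist_flatten_replicate {α : Type*} (u : List α) (l : List α) (h : ∀ a ∈ l, a ∈ u) :
    l.Sublist (List.replicate l.length u).flatten := by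
  induction l with
  | nil => simp
  | cons a l ih =>
    rw [List.length_cons, List.replicate_succ, List.flatten_cons, ← List.singleton_append]
    exact List.Sublist.append (List.singleton_sublist.2 (h a (by simp)))
      (ih fun b hb => h b (by simp [hb]))

theorem exists_isComplete (n : ℕ) : ∃ w : List (Fin n), w.length = n ^ 2 ∧ IsComplete w := by
  refine ⟨(List.replicate n (List.finRange n)).flatten, by simp [pow_two], fun σ => ?_⟩
  have := sublist_flatten_replicate (List.finRange n) (List.ofFn σ) (by simp)
  rwa [List.length_ofFn] at this

end BooleanNetwork

/-! ### Signs of closed walks and Harary's switching theorem. -/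

namespace SignedDigraph

variable {V : Type} {G : SignedDigraph V}

/-- `G.Walk u v s`: there is a walk of sign `s` from `u` to `v`. -/
inductive Walk (G : SignedDigraph V) : V → V → ℤˣ → Prop
  | nil (v : V) : Walk G v v 1
  | cons {u v w : V} {s t : ℤˣ} : G.Arc u v s → Walk G v w t → Walk G u w (s * t)

theorem Walk.trans {u v w : V} {s t : ℤˣ} (h : G.Walk u v s) (h' : G.Walk v w t) :
    G.Walk u w (s * t) := by
  induction h with
  | nil => simpa using h'
  | cons a _ ih => rw [mul_assoc]; exact .cons a (ih h')

theorem Walk.concat {u v w : V} {s t : ℤˣ} (h : G.Walk u v s) (a : G.Arc v w t) :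
    G.Walk u w (s * t) := by
  have := h.trans (.cons a (.nil w))
  simpa using this

theorem Walk.exists_sequence {u w : V} {σ : ℤˣ} (h : G.Walk u w σ) :
    ∃ (L : ℕ) (v : ℕ → V) (s : ℕ → ℤˣ), v 0 = u ∧ v L = w ∧
      (∀ t < L, G.Arc (v t) (v (t + 1)) (s t)) ∧ ∏ t ∈ Finset.range L, s t = σ := by
  induction h with
  | nil v => exact ⟨0, fun _ => v, fun _ => 1, rfl, rfl, by simp, by simp⟩
  | @cons u _ w s _ a _ ih =>
    obtain ⟨L, v, r, h0, hL, ha, hp⟩ := ih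
    refine ⟨L + 1, fun t => Nat.casesOn t u v, fun t => Nat.casesOn t s r, rfl, hL, ?_, ?_⟩
    · rintro (_ | t) ht
      · simpa [h0] using a
      · exact ha t (by omega)
    · rw [Finset.prod_range_succ', mul_comm]
      exact congrArg _ hp

/-- A closed walk either is a cycle or splits at a repeated vertex into two shorter closed walks,
whose signs multiply. -/
theorem NoNegativeCycles.prod_eq_one (hG : G.NoNegativeCycles) (L : ℕ) (v : ℕ → V) (s : ℕ → ℤˣ)
    (hv : v 0 = v L) (ha : ∀ t < L, G.Arc (v t) (v (t + 1)) (s t)) :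
    ∏ t ∈ Finset.range L, s t = 1 := by
  induction L using Nat.strong_induction_on generalizing v s with
  | _ L ih =>
  rcases Nat.eq_zero_or_pos L with rfl | hL
  · simp
  by_cases hinj : ∀ i j, i < j → j < L → v i ≠ v j
  · obtain ⟨k, rfl⟩ : ∃ k, L = k + 1 := ⟨L - 1, by omega⟩
    let C : G.Cycle :=
      { k := k
        v := fun t => v t
        s := fun t => s t
        injective_v := by
          intro i j hij
          rcases lt_trichotomy i.val j.val with h | h | h
          · exact absurd hij (hinj _ _ h j.isLt)
          · exact Fin.ext h
          · exact absurd hij.symm (hinj _ _ h i.isLt)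
        arc := by
          intro t
          have := ha t t.isLt
          rcases eq_or_ne t (Fin.last k) with rfl | ht
          · simpa [hv] using this
          · rwa [Fin.val_add_one_of_lt (Fin.lt_last_iff_ne_last.2 ht)] }
    have h := hG C
    rw [Finset.prod_range]
    exact (Int.units_eq_one_or _).resolve_right h
  · push Not at hinj
    obtain ⟨i, j, hij, hjL, hvij⟩ := hinj
    obtain ⟨d, rfl⟩ : ∃ d, j = i + d := ⟨j - i, by omega⟩
    obtain ⟨r, rfl⟩ : ∃ r, L = i + d + r := ⟨L - (i + d), by omega⟩
    have h₁ := ih d (by omega) (fun t => v (i + t)) (fun t => s (i + t)) (by simpa using hvij)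
      (fun t ht => ha (i + t) (by omega))
    -- The remaining closed walk, with the `d` steps between the two visits cut out.
    have h₂ := ih (i + r) (by omega) (fun t => if t ≤ i then v t else v (t + d))
      (fun t => if t < i then s t else s (t + d))
      (by
        have : ¬ i + r ≤ i := by omega
        simp only [Nat.zero_le, if_true, this, if_false, hv]
        congr 1; omega)
      (by
        intro t ht
        rcases lt_trichotomy t i with h | rfl | h
        · simpa [h, h.le, Nat.succ_le_of_lt h] using ha t (by omega)
        · have := ha (t + d) (by omega)
          simp only [le_refl, if_true, lt_irrefl, if_false, hvij]
          rw [if_neg (by omega)]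
          convert this using 2; omega
        · rw [if_neg (by omega), if_neg (by omega), if_neg (by omega)]
          have := ha (t + d) (by omega)
          convert this using 2; omega)
    rw [Finset.prod_range_add, Finset.prod_range_add, h₁, mul_one]
    rw [Finset.prod_range_add] at h₂
    rw [← h₂]
    congr 1
    · refine Finset.prod_congr rfl fun t ht => ?_
      rw [if_pos (Finset.mem_range.1 ht)]
    · refine Finset.prod_congr rfl fun t _ => ?_
      rw [if_neg (by omega)]
      congr 1; omega

theorem NoNegativeCycles.walk_sign (hG : G.NoNegativeCycles) {v : V} {σ : ℤˣ}
    (h : G.Walk v v σ) : σ = 1 := by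
  obtain ⟨L, u, s, h0, hL, ha, rfl⟩ := h.exists_sequence
  exact hG.prod_eq_one L u s (h0.trans hL.symm) ha

/-- Harary's theorem for a strongly connected set of vertices: without negative cycles, a suitable
switch makes all its arcs positive. -/
theorem NoNegativeCycles.exists_switch (hG : G.NoNegativeCycles) (S : Set V) (v : V)
    (hto : ∀ u ∈ S, ∃ σ, G.Walk u v σ) (hfrom : ∀ u ∈ S, ∃ σ, G.Walk v u σ) :
    ∃ a : V → Bool, ∀ i ∈ S, ∀ j ∈ S, ∀ s, G.Arc j i s → (s = 1 ↔ a j = a i) := by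
  classical
  choose! α hα using hfrom
  -- Switch by the sign of a chosen walk from `v`. Closing the walks to `i`, directly or through
  -- `j`, by the same walk back to `v` shows that the signs are consistent along arcs.
  refine ⟨fun u => decide (α u = 1), fun i hi j hj s hs => ?_⟩
  obtain ⟨β, hβ⟩ := hto i hi
  have h₁ := hG.walk_sign ((hα i hi).trans hβ)
  have h₂ := hG.walk_sign (((hα j hj).concat hs).trans hβ)
  have h₃ : α j * s = α i := mul_right_cancel (h₂.trans h₁.symm)
  rcases Int.units_eq_one_or (α j) with h | h <;> rcases Int.units_eq_one_or s with h' | h' <;>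
    rw [h, h'] at h₃ <;> simp [← h₃, h, h']

end SignedDigraph

/-! ### Every complete word synchronizes. -/

namespace BooleanNetwork

variable {V : Type} [DecidableEq V]

theorem switched_step_le {f : BooleanNetwork V} {a : V → Bool} {i j : V} (u : V → Bool) (b : Bool)
    (h : u j = b ∨ (∀ s, ¬ f.interactionDigraph.Arc j i s) ∨
      ((u j ^^ a j) ≤ (b ^^ a j) ∧ ∀ s, f.interactionDigraph.Arc j i s → (s = 1 ↔ a j = a i))) :
    (f u i ^^ a i) ≤ (f (Function.update u j b) i ^^ a i) := by
  by_cases hb : u j = b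
  · rw [← hb, Function.update_eq_self]
  have pos : ∀ x : V → Bool, x j = false → f x i = false →
      f (Function.update x j true) i = true → f.interactionDigraph.Arc j i 1 :=
    fun x hx h0 h1 => ⟨x, hx, Or.inl ⟨rfl, by rw [h0, h1]; decide⟩⟩
  have neg : ∀ x : V → Bool, x j = false → f x i = true →
      f (Function.update x j true) i = false → f.interactionDigraph.Arc j i (-1) :=
    fun x hx h0 h1 => ⟨x, hx, Or.inr ⟨rfl, by rw [h0, h1]; decide⟩⟩
  rcases h with h | h | ⟨hle, h⟩
  · exact absurd h hb
  · cases b with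
    | true =>
      have hu : u j = false := by simpa using hb
      cases h0 : f u i <;> cases h1 : f (Function.update u j true) i <;> simp
      · exact absurd (pos u hu h0 h1) (h _)
      · exact absurd (neg u hu h0 h1) (h _)
    | false =>
      have hu : u j = true := by simpa using hb
      have hu' : Function.update (Function.update u j false) j true = u := by
        rw [Function.update_idem, ← hu, Function.update_eq_self]
      cases h0 : f u i <;> cases h1 : f (Function.update u j false) i <;> simp
      · exact absurd (neg _ (by simp) h1 (by rw [hu', h0])) (h _)
      · exact absurd (pos _ (by simp) h1 (by rw [hu', h0])) (h _)
  · cases b with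
    | true =>
      have hu : u j = false := by simpa using hb
      have haj : a j = false := by revert hle; rw [hu]; cases a j <;> decide
      cases h0 : f u i <;> cases h1 : f (Function.update u j true) i <;> simp
      · have := (h _ (pos u hu h0 h1)).1 rfl
        rw [← this, haj]; decide
      · have : ¬ a j = a i := fun e => absurd ((h _ (neg u hu h0 h1)).2 e) (by decide)
        rw [haj] at this
        rw [show a i = true by revert this; cases a i <;> simp]; decide
    | false =>
      have hu : u j = true := by simpa using hb
      have hu' : Function.update (Function.update u j false) j true = u := by
        rw [Function.update_idem, ← hu, Function.update_eq_self]
      have haj : a j = true := by revert hle; rw [hu]; cases a j <;> decide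
      cases h0 : f u i <;> cases h1 : f (Function.update u j false) i <;> simp
      · have : ¬ a j = a i := fun e =>
          absurd ((h _ (neg _ (by simp) h1 (by rw [hu', h0]))).2 e) (by decide)
        rw [haj] at this
        rw [show a i = false by revert this; cases a i <;> simp]; decide
      · have := (h _ (pos _ (by simp) h1 (by rw [hu', h0]))).1 rfl
        rw [← this, haj]; decide

/-- Pass from `x` to `y` one coordinate at a time. Each change is idle, invisible to `i`, or upward
in the switched order along an arc that the switch makes positive. -/
theorem switched_le [Fintype V] {f : BooleanNetwork V} {a : V → Bool} {i : V} (x y : V → Bool)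
    (h : ∀ j, x j = y j ∨ (∀ s, ¬ f.interactionDigraph.Arc j i s) ∨
      ((x j ^^ a j) ≤ (y j ^^ a j) ∧ ∀ s, f.interactionDigraph.Arc j i s → (s = 1 ↔ a j = a i))) :
    (f x i ^^ a i) ≤ (f y i ^^ a i) := by
  have key : ∀ T : Finset V,
      (f x i ^^ a i) ≤ (f (fun j => if j ∈ T then y j else x j) i ^^ a i) := by
    intro T
    induction T using Finset.induction_on with
    | empty => simp
    | insert j T hj ih =>
      refine ih.trans ?_
      have e : (fun k => if k ∈ insert j T then y k else x k) =
          Function.update (fun k => if k ∈ T then y k else x k) j (y j) := by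
        funext k
        by_cases hk : k = j
        · subst hk; simp
        · simp [hk]
      rw [e]
      apply switched_step_le
      simpa [hj] using h j
  simpa using key Finset.univ

/-- `E` contains all in-neighbours of its elements. -/
def PredClosed (f : BooleanNetwork V) (E : Finset V) : Prop :=
  ∀ i ∈ E, ∀ j s, f.interactionDigraph.Arc j i s → j ∈ E

theorem PredClosed.congr [Fintype V] {f : BooleanNetwork V} {E : Finset V} (hE : f.PredClosed E)
    {x y : V → Bool} (h : ∀ j ∈ E, x j = y j) {i : V} (hi : i ∈ E) : f x i = f y i := by
  have key : ∀ x y : V → Bool, (∀ j ∈ E, x j = y j) → f x i ≤ f y i := by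
    intro x y h
    have := switched_le (f := f) (a := fun _ => false) (i := i) x y fun j => by
      by_cases hj : j ∈ E
      · exact Or.inl (h j hj)
      · exact Or.inr (Or.inl fun s hs => hj (hE i hi j s hs))
    simpa using this
  exact le_antisymm (key x y h) (key y x fun j hj => (h j hj).symm)

theorem PredClosed.actWord_eq [Fintype V] {f : BooleanNetwork V} {E : Finset V}
    (hE : f.PredClosed E) {p : V → Bool} (hp : ∀ i ∈ E, f p i = p i) (w : List V)
    (x : V → Bool) (hx : ∀ i ∈ E, x i = p i) : ∀ i ∈ E, f.actWord w x i = p i := by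
  induction w generalizing x with
  | nil => exact hx
  | cons k w ih =>
    rw [actWord_cons]
    refine ih _ fun i hi => ?_
    by_cases hk : i = k
    · subst hk
      rw [act, Function.update_self, hE.congr hx hi, hp i hi]
    · rw [act, Function.update_of_ne hk, hx i hi]

/-- On the invariant set `X` of configurations, the components in `S` are monotone for the order
obtained by switching the components along `a`. -/
structure SwitchedMonotone (f : BooleanNetwork V) (X : Set (V → Bool)) (S : Finset V)
    (a : V → Bool) : Prop where
  act_mem : ∀ x ∈ X, ∀ i, f.act i x ∈ X
  mono : ∀ x ∈ X, ∀ y ∈ X, (∀ j ∈ S, (x j ^^ a j) ≤ (y j ^^ a j)) →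
    ∀ i ∈ S, (f x i ^^ a i) ≤ (f y i ^^ a i)

namespace SwitchedMonotone

variable {f : BooleanNetwork V} {X : Set (V → Bool)} {S : Finset V} {a : V → Bool}

theorem le_act {x : V → Bool} (hxf : ∀ i ∈ S, (x i ^^ a i) ≤ (f x i ^^ a i)) (k : V) :
    ∀ i ∈ S, (x i ^^ a i) ≤ (f.act k x i ^^ a i) := by
  intro i hi
  by_cases hk : i = k
  · subst hk; rw [act, Function.update_self]; exact hxf i hi
  · rw [act, Function.update_of_ne hk]

theorem act_le (h : SwitchedMonotone f X S a) {x : V → Bool} (hx : x ∈ X)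
    (hxf : ∀ i ∈ S, (x i ^^ a i) ≤ (f x i ^^ a i)) (k : V) :
    ∀ i ∈ S, (f.act k x i ^^ a i) ≤ (f (f.act k x) i ^^ a i) := by
  intro i hi
  have hm := h.mono x hx _ (h.act_mem x hx k) (le_act hxf k) i hi
  refine le_trans ?_ hm
  by_cases hk : i = k
  · subst hk; rw [act, Function.update_self]
  · rw [act, Function.update_of_ne hk]; exact hxf i hi

/-- Updating any unstable component of `S` raises it, and monotonicity keeps the configuration below
its image. So no component ever falls, each is updated at most once, and the process stops at a
fixed point on `S`. -/
theorem exists_climb (h : SwitchedMonotone f X S a) (x : V → Bool) (hx : x ∈ X)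
    (hxf : ∀ i ∈ S, (x i ^^ a i) ≤ (f x i ^^ a i)) :
    ∃ l : List V, l.Nodup ∧
      (∀ i, i ∈ l ↔ i ∈ S ∧ (x i ^^ a i) = false ∧ (f.actWord l x i ^^ a i) = true) ∧
      (∀ i ∈ S, (x i ^^ a i) ≤ (f.actWord l x i ^^ a i)) ∧
      (∀ i ∈ S, f (f.actWord l x) i = f.actWord l x i) ∧ f.actWord l x ∈ X := by
  induction hn : (S.filter fun i => (x i ^^ a i) = false).card using Nat.strong_induction_on
    generalizing x with
  | _ n ih =>
  by_cases hfix : ∀ i ∈ S, f x i = x i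
  · exact ⟨[], by simp, by simp, by simp, hfix, hx⟩
  push Not at hfix
  obtain ⟨k, hkS, hk⟩ := hfix
  have hk0 : (x k ^^ a k) = false ∧ (f x k ^^ a k) = true := by
    have := hxf k hkS
    revert this hk
    cases x k <;> cases f x k <;> cases a k <;> decide
  have hself : (f.act k x k ^^ a k) = true := by rw [act, Function.update_self]; exact hk0.2
  have hne : ∀ i, i ≠ k → f.act k x i = x i := fun i hi => by
    rw [act, Function.update_of_ne hi]
  obtain ⟨l, hl, hmem, hle, hfix, hX⟩ := ih _ (by
      rw [← hn]
      refine Finset.card_lt_card ?_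
      rw [Finset.ssubset_iff_of_subset]
      · exact ⟨k, Finset.mem_filter.2 ⟨hkS, hk0.1⟩, fun hk' =>
          absurd (hself.symm.trans (Finset.mem_filter.1 hk').2) (by decide)⟩
      · intro i
        simp only [Finset.mem_filter]
        rintro ⟨hi, hi0⟩
        refine ⟨hi, ?_⟩
        rw [← hne i]
        · exact hi0
        · rintro rfl
          rw [hself] at hi0
          exact absurd hi0 (by decide))
    (f.act k x) (h.act_mem x hx k) (h.act_le hx hxf k) rfl
  refine ⟨k :: l, ?_, ?_, ?_, hfix, hX⟩
  · refine List.nodup_cons.2 ⟨fun hkl => ?_, hl⟩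
    have := ((hmem k).1 hkl).2.1
    rw [hself] at this
    exact absurd this (by decide)
  · intro i
    rw [actWord_cons, List.mem_cons]
    by_cases hi : i = k
    · subst hi
      refine ⟨fun _ => ⟨hkS, hk0.1, ?_⟩, fun _ => Or.inl rfl⟩
      have := hle i hkS
      rw [hself] at this
      revert this
      cases (f.actWord l (f.act i x) i ^^ a i) <;> decide
    · rw [hmem i, hne i hi]
      simp [hi]
  · intro i hi
    exact (le_act hxf k i hi).trans (hle i hi)

/-- A letter of `w` skipped by `l` cannot bring `y` below `x`, because `x ≤ f x ≤ f y` on `S` in the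
switched order. -/
theorem actWord_le (h : SwitchedMonotone f X S a) {l w : List V} (hlw : l.Sublist w)
    (x y : V → Bool) (hx : x ∈ X) (hy : y ∈ X)
    (hxf : ∀ i ∈ S, (x i ^^ a i) ≤ (f x i ^^ a i))
    (hxy : ∀ i ∈ S, (x i ^^ a i) ≤ (y i ^^ a i)) :
    ∀ i ∈ S, (f.actWord l x i ^^ a i) ≤ (f.actWord w y i ^^ a i) := by
  induction hlw generalizing x y with
  | slnil => exact hxy
  | cons k _ ih =>
    rw [actWord_cons]
    refine ih x (f.act k y) hx (h.act_mem y hy k) hxf fun i hi => ?_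
    by_cases hk : i = k
    · subst hk
      rw [act, Function.update_self]
      exact (hxf i hi).trans (h.mono x hx y hy hxy i hi)
    · rw [act, Function.update_of_ne hk]; exact hxy i hi
  | cons_cons k _ ih =>
    rw [actWord_cons, actWord_cons]
    refine ih _ _ (h.act_mem x hx k) (h.act_mem y hy k) (h.act_le hx hxf k) fun i hi => ?_
    by_cases hk : i = k
    · subst hk
      rw [act, act, Function.update_self, Function.update_self]
      exact h.mono x hx y hy hxy i hi
    · rw [act, act, Function.update_of_ne hk, Function.update_of_ne hk]; exact hxy i hi

/-- Complementing the switch reverses the order, so descents are climbs for the dual switch. -/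
theorem dual (h : SwitchedMonotone f X S a) : SwitchedMonotone f X S fun i => !a i where
  act_mem := h.act_mem
  mono := by
    have key : ∀ b b' c : Bool, (b ^^ !c) ≤ (b' ^^ !c) ↔ (b' ^^ c) ≤ (b ^^ c) := by decide
    intro x hx y hy hxy i hi
    rw [key]
    exact h.mono y hy x hx (fun j hj => (key _ _ _).1 (hxy j hj)) i hi

end SwitchedMonotone

variable [Fintype V]

/-- The word `l`, which lists `E` without repetition, drives the components in `E` to a fixed
configuration, and so does every word that contains `l`. -/
def Settles (f : BooleanNetwork V) (E : Finset V) (l : List V) (c : V → Bool) : Prop :=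
  l.Nodup ∧ (∀ i, i ∈ l ↔ i ∈ E) ∧ (∀ i ∈ E, f c i = c i) ∧
    ∀ w x, l.Sublist w → ∀ i ∈ E, f.actWord w x i = c i

theorem Settles.exists_extend {f : BooleanNetwork V} (hs : f.IsSynchronizing) {D S : Finset V}
    {l : List V} {c : V → Bool} (hl : f.Settles D l c) (hdisj : Disjoint D S)
    (hD : f.PredClosed D) (hDS : f.PredClosed (D ∪ S)) {a : V → Bool}
    (ha : ∀ i ∈ S, ∀ j ∈ S, ∀ s, f.interactionDigraph.Arc j i s → (s = 1 ↔ a j = a i)) :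
    ∃ l' c', f.Settles (D ∪ S) l' c' := by
  obtain ⟨hnd, hmem, hfix, hset⟩ := hl
  set X : Set (V → Bool) := {x | ∀ j ∈ D, x j = c j}
  have hsm : SwitchedMonotone f X S a := by
    refine ⟨fun x hx i => ?_, fun x hx y hy hxy i hi => switched_le x y fun j => ?_⟩
    · exact hD.actWord_eq hfix [i] x hx
    · by_cases hj : j ∈ D
      · exact Or.inl ((hx j hj).trans (hy j hj).symm)
      · by_cases hj' : j ∈ S
        · exact Or.inr (Or.inr ⟨hxy j hj', ha i hi j hj'⟩)
        · refine Or.inr (Or.inl fun s hsa => ?_)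
          have := hDS i (Finset.mem_union_right _ hi) j s hsa
          simp [hj, hj'] at this
  have climb : ∀ a : V → Bool, SwitchedMonotone f X S a → ∃ (l : List V) (p : V → Bool), l.Nodup ∧
      (∀ i, i ∈ l ↔ i ∈ S ∧ (p i ^^ a i) = true) ∧ (∀ i ∈ S, f p i = p i) ∧ p ∈ X ∧
      ∀ w, ∀ y ∈ X, l.Sublist w → ∀ i ∈ S, (p i ^^ a i) ≤ (f.actWord w y i ^^ a i) := by
    intro a hsm
    -- The least configuration on `S` in the switched order, with `D` already settled.
    let m : V → Bool := fun j => if j ∈ S then a j else c j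
    have hm : m ∈ X := fun j hj => if_neg (Finset.disjoint_left.1 hdisj hj)
    have hm0 : ∀ i ∈ S, (m i ^^ a i) = false := fun i hi => by simp [m, hi]
    have hmf : ∀ y : V → Bool, ∀ i ∈ S, (m i ^^ a i) ≤ (y i ^^ a i) := fun y i hi => by
      rw [hm0 i hi]; exact Bool.false_le _
    obtain ⟨l, h₁, h₂, -, h₄, h₅⟩ := hsm.exists_climb m hm (hmf _)
    refine ⟨l, f.actWord l m, h₁, fun i => ?_, h₄, h₅, fun w y hy hlw => ?_⟩
    · rw [h₂ i]
      exact ⟨fun h => ⟨h.1, h.2.2⟩, fun h => ⟨h.1, hm0 i h.1, h.2⟩⟩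
    · exact hsm.actWord_le hlw m y hm hy (hmf _) (hmf _)
  obtain ⟨lu, p, hlu, hmu, hpf, hpX, hup⟩ := climb a hsm
  obtain ⟨ld, q, hld, hmd, hqf, hqX, hdown⟩ := climb _ hsm.dual
  have fixed : ∀ p ∈ X, (∀ i ∈ S, f p i = p i) → ∀ i ∈ D ∪ S, f p i = p i := by
    intro p hpX hpf i hi
    rcases Finset.mem_union.1 hi with h | h
    · rw [hD.congr hpX h, hfix i h, hpX i h]
    · exact hpf i h
  -- Both configurations are fixed on the closed set `D ∪ S`, hence survive there under any word; a
  -- synchronizing word identifies them.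
  have hpq : ∀ i ∈ S, p i = q i := by
    obtain ⟨u, d, hu⟩ := hs
    intro i hi
    have hi' := Finset.mem_union_right D hi
    rw [← hDS.actWord_eq (fixed p hpX hpf) u p (fun _ _ => rfl) i hi',
      ← hDS.actWord_eq (fixed q hqX hqf) u q (fun _ _ => rfl) i hi', hu p, hu q]
  -- As `p = q` on `S`, `lu` lists the components where the common value is switched-true and `ld`
  -- those where it is switched-false.
  refine ⟨l ++ (lu ++ ld), p, ?_, ?_, fixed p hpX hpf, ?_⟩
  · refine hnd.append (hlu.append hld ?_) ?_
    · intro i hi hi'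
      have h₁ := (hmu i).1 hi
      have h₂ := ((hmd i).1 hi').2
      rw [← hpq i h₁.1] at h₂
      have h₃ := h₁.2
      revert h₂ h₃
      cases p i <;> cases a i <;> decide
    · intro i hi hi'
      have h₁ := Finset.disjoint_left.1 hdisj ((hmem i).1 hi)
      rcases List.mem_append.1 hi' with h | h
      · exact h₁ ((hmu i).1 h).1
      · exact h₁ ((hmd i).1 h).1
  · intro i
    rw [List.mem_append, List.mem_append, Finset.mem_union, hmem, hmu, hmd]
    refine or_congr Iff.rfl ⟨fun h => h.elim And.left And.left, fun h => ?_⟩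
    rw [← hpq i h]
    cases p i <;> cases a i <;> simp [h]
  · intro w x hw
    obtain ⟨w₁, w₂, rfl, hw₁, hw₂⟩ := List.append_sublist_iff.1 hw
    rw [actWord_append]
    have hy : f.actWord w₁ x ∈ X := hset w₁ x hw₁
    intro i hi
    rcases Finset.mem_union.1 hi with h | h
    · rw [hD.actWord_eq hfix w₂ _ hy i h, hpX i h]
    · have h₁ := hup w₂ _ hy ((List.sublist_append_left _ _).trans hw₂) i h
      have h₂ := hdown w₂ _ hy ((List.sublist_append_right _ _).trans hw₂) i h
      rw [← hpq i h] at h₂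
      revert h₁ h₂
      cases p i <;> cases f.actWord w₂ (f.actWord w₁ x) i <;> cases a i <;> decide

/-- Take `v` outside `D` with fewest ancestors outside `D`. An ancestor of `v` has no more ancestors
than `v`, hence by minimality the same ones, including `v` itself. -/
theorem exists_component {G : SignedDigraph V} {D : Finset V} (hD : D ≠ Finset.univ) :
    ∃ (S : Finset V) (v : V), v ∈ S ∧ Disjoint D S ∧ (∀ u ∈ S, ∃ σ, G.Walk u v σ) ∧
      (∀ u ∈ S, ∃ σ, G.Walk v u σ) ∧ ∀ i ∈ S, ∀ j s, G.Arc j i s → j ∈ D ∪ S := by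
  classical
  let anc : V → Finset V := fun u => Finset.univ.filter fun j => j ∉ D ∧ ∃ σ, G.Walk j u σ
  have hne : (Finset.univ \ D).Nonempty := by
    rw [Finset.sdiff_nonempty]
    exact fun h => hD (Finset.univ_subset_iff.1 h)
  obtain ⟨v, hv, hmin⟩ := Finset.exists_min_image _ (fun u => (anc u).card) hne
  have hvD : v ∉ D := (Finset.mem_sdiff.1 hv).2
  have hvv : v ∈ anc v := by simpa [anc, hvD] using ⟨_, SignedDigraph.Walk.nil v⟩
  refine ⟨anc v, v, hvv, ?_, ?_, ?_, ?_⟩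
  · rw [Finset.disjoint_right]
    intro u hu
    exact (Finset.mem_filter.1 hu).2.1
  · intro u hu
    exact (Finset.mem_filter.1 hu).2.2
  · intro u hu
    obtain ⟨huD, σ, hσ⟩ := (Finset.mem_filter.1 hu).2
    have hsub : anc u ⊆ anc v := by
      intro j hj
      obtain ⟨hjD, τ, hτ⟩ := (Finset.mem_filter.1 hj).2
      exact Finset.mem_filter.2 ⟨Finset.mem_univ _, hjD, _, hτ.trans hσ⟩
    have := Finset.eq_of_subset_of_card_le hsub (hmin u (by simp [huD]))
    rw [← this] at hvv
    exact (Finset.mem_filter.1 hvv).2.2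
  · intro i hi j s hs
    obtain ⟨-, σ, hσ⟩ := (Finset.mem_filter.1 hi).2
    by_cases hj : j ∈ D
    · exact Finset.mem_union_left _ hj
    · exact Finset.mem_union_right _
        (Finset.mem_filter.2 ⟨Finset.mem_univ _, hj, _, .cons hs hσ⟩)

theorem exists_settles {f : BooleanNetwork V} (hs : f.IsSynchronizing)
    (hG : f.interactionDigraph.NoNegativeCycles) : ∃ l c, f.Settles Finset.univ l c := by
  have key : ∀ m : ℕ, ∀ D : Finset V, (Finset.univ \ D).card = m → f.PredClosed D →
      (∃ l c, f.Settles D l c) → ∃ l c, f.Settles Finset.univ l c := by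
    intro m
    induction m using Nat.strong_induction_on with
    | _ m ih =>
    rintro D rfl hD ⟨l, c, hl⟩
    by_cases hu : D = Finset.univ
    · exact hu ▸ ⟨l, c, hl⟩
    obtain ⟨S, v, hvS, hdisj, hto, hfrom, hS⟩ := exists_component (G := f.interactionDigraph) hu
    obtain ⟨a, ha⟩ := hG.exists_switch S v hto hfrom
    have hDS : f.PredClosed (D ∪ S) := by
      intro i hi j s hj
      rcases Finset.mem_union.1 hi with h | h
      · exact Finset.mem_union_left _ (hD i h j s hj)
      · exact hS i h j s hj
    refine ih _ ?_ (D ∪ S) rfl hDS (hl.exists_extend hs hdisj hD hDS ha)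
    refine Finset.card_lt_card ?_
    rw [Finset.ssubset_iff_of_subset
      (Finset.sdiff_subset_sdiff le_rfl Finset.subset_union_left)]
    exact ⟨v, by simpa using Finset.disjoint_right.1 hdisj hvS, by simp [hvS]⟩
  exact key _ ∅ rfl (by simp [PredClosed]) ⟨[], fun _ => false, by simp [Settles]⟩

theorem IsComplete.sublist_of_nodup {n : ℕ} {w : List (Fin n)} (h : IsComplete w)
    {l : List (Fin n)} (hl : l.Nodup) : l.Sublist w := by
  obtain ⟨L, hlL, hL, hmem⟩ : ∃ L, l.Sublist L ∧ L.Nodup ∧ ∀ i, i ∈ L := by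
    refine ⟨l ++ (List.finRange n).filter fun i => i ∉ l, List.sublist_append_left _ _,
      hl.append ((List.nodup_finRange n).filter _) ?_, ?_⟩
    · intro i hi hi'
      simp [hi] at hi'
    · intro i
      by_cases hi : i ∈ l <;> simp [hi]
  have hlen : L.length = n := by
    have h₁ : L.toFinset = Finset.univ := by ext i; simp [hmem]
    rw [← List.toFinset_card_of_nodup hL, h₁, Finset.card_univ, Fintype.card_fin]
  have hinj : Function.Injective fun i : Fin n => L.get (Fin.cast hlen.symm i) :=
    (List.nodup_iff_injective_get.1 hL).comp (Fin.cast_injective _)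
  have hσ := h (Equiv.ofBijective _ (Finite.injective_iff_bijective.1 hinj))
  refine hlL.trans (Eq.subst (motive := fun K : List (Fin n) => K.Sublist w) ?_ hσ)
  refine List.ext_getElem (by simp [hlen]) fun k h₁ h₂ => by simp

theorem synchronizesSet_of_isComplete {n : ℕ} {w : List (Fin n)} (h : IsComplete w) :
    SynchronizesSet w (FPlus n) := by
  rintro f ⟨hs, hG⟩
  obtain ⟨l, c, hnd, -, -, hl⟩ := exists_settles hs hG
  exact ⟨c, fun x => funext fun i => hl w x (h.sublist_of_nodup hnd) i (Finset.mem_univ _)⟩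

theorem synchronizesSet_iff_isComplete {n : ℕ} {w : List (Fin n)} :
    SynchronizesSet w (FPlus n) ↔ IsComplete w :=
  ⟨isComplete_of_synchronizesSet, synchronizesSet_of_isComplete⟩

theorem isLeast_ellPlus (n : ℕ) : IsLeast (syncLengths n) (ellPlus n) := by
  obtain ⟨w, hw, hc⟩ := exists_isComplete n
  exact ⟨Nat.sInf_mem ⟨_, w, hw, synchronizesSet_of_isComplete hc⟩, fun m hm => Nat.sInf_le hm⟩

theorem ellPlus_le (n : ℕ) : ellPlus n ≤ n ^ 2 := by
  obtain ⟨w, hw, hc⟩ := exists_isComplete n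
  exact Nat.sInf_le ⟨w, hw, synchronizesSet_of_isComplete hc⟩

end BooleanNetwork

/-! ### Interval covers, multiplicative weights, matchings and missing arrangements. -/

section Covering

open Finset

/-- Integral covers of an initial segment of `ℕ` by intervals are as cheap as fractional ones. -/
theorem exists_cover_cost_le (b : ℕ) (E : Finset (ℕ × ℕ)) (Y c : ℕ × ℕ → ℝ) (q : ℝ) (hq : 0 < q)
    (hE : ∀ e ∈ E, e.1 < e.2 ∧ e.2 ≤ b) (hc : ∀ e ∈ E, 0 ≤ c e) (hY : ∀ e ∈ E, 0 ≤ Y e)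
    (hcov : ∀ t < b, q ≤ ∑ e ∈ E with e.1 ≤ t ∧ t < e.2, Y e) :
    ∃ τ ⊆ E, (∀ t < b, ∃ e ∈ τ, e.1 ≤ t ∧ t < e.2) ∧ q * ∑ e ∈ τ, c e ≤ ∑ e ∈ E, Y e * c e := by
  classical
  have hmin : ∀ t, ∃ τ ⊆ E, (∀ r < t, r < b → ∃ e ∈ τ, e.1 ≤ r ∧ r < e.2) ∧
      ∀ τ' ⊆ E, (∀ r < t, r < b → ∃ e ∈ τ', e.1 ≤ r ∧ r < e.2) →
        ∑ e ∈ τ, c e ≤ ∑ e ∈ τ', c e := by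
    intro t
    obtain ⟨τ, hτ, hm⟩ := exists_min_image
      (E.powerset.filter fun τ => ∀ r < t, r < b → ∃ e ∈ τ, e.1 ≤ r ∧ r < e.2)
      (fun τ => ∑ e ∈ τ, c e) ⟨E, by
        simp only [mem_filter, mem_powerset, Subset.refl, true_and]
        intro r _ hr
        by_contra! hcon
        have h := hcov r hr
        rw [filter_false_of_mem, sum_empty] at h
        · linarith
        · intro e he h'
          exact absurd h'.2 (not_lt.2 (hcon e he h'.1))⟩
    simp only [mem_filter, mem_powerset] at hτ hm
    exact ⟨τ, hτ.1, hτ.2, fun τ' h₁ h₂ => hm τ' ⟨h₁, h₂⟩⟩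
  choose τ hτE hτcov hτmin using hmin
  -- The least cost of covering the cells below `t`. Its increments are a feasible dual solution:
  -- nonnegative, and summing to at most `c e` over each interval `e`.
  set d : ℕ → ℝ := fun t => ∑ e ∈ τ t, c e with hd
  have hd0 : d 0 = 0 :=
    le_antisymm (by simpa using hτmin 0 ∅ (by simp) (by simp))
      (sum_nonneg fun e he => hc e (hτE 0 he))
  have hmono : ∀ t, 0 ≤ d (t + 1) - d t := fun t => sub_nonneg.2
    (hτmin t (τ (t + 1)) (hτE _) fun r hr => hτcov (t + 1) r (by omega))
  have hstep : ∀ e ∈ E, d e.2 - d e.1 ≤ c e := by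
    intro e he
    have h := hτmin e.2 (insert e (τ e.1)) (insert_subset he (hτE _)) (by
      intro r hr hrb
      by_cases h : r < e.1
      · obtain ⟨e', he', h'⟩ := hτcov e.1 r h hrb
        exact ⟨e', mem_insert_of_mem he', h'⟩
      · exact ⟨e, mem_insert_self _ _, not_lt.1 h, hr⟩)
    have h' : ∑ e' ∈ insert e (τ e.1), c e' ≤ c e + d e.1 := by
      by_cases hmem : e ∈ τ e.1
      · rw [insert_eq_of_mem hmem]
        linarith [hc e he]
      · rw [sum_insert hmem]
    simp only [hd] at h h' ⊢
    linarith
  refine ⟨τ b, hτE b, fun t ht => hτcov b t ht ht, ?_⟩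
  calc q * ∑ e ∈ τ b, c e = ∑ t ∈ range b, (d (t + 1) - d t) * q := by
        rw [← sum_mul, sum_range_sub, hd0, sub_zero, mul_comm]
    _ ≤ ∑ t ∈ range b, (d (t + 1) - d t) * ∑ e ∈ E with e.1 ≤ t ∧ t < e.2, Y e :=
        sum_le_sum fun t ht => mul_le_mul_of_nonneg_left (hcov t (mem_range.1 ht)) (hmono t)
    _ = ∑ e ∈ E, Y e * ∑ t ∈ range b with e.1 ≤ t ∧ t < e.2, (d (t + 1) - d t) := by
        simp_rw [sum_filter, mul_sum]
        rw [sum_comm]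
        refine sum_congr rfl fun e _ => sum_congr rfl fun t _ => ?_
        split_ifs <;> ring
    _ ≤ ∑ e ∈ E, Y e * c e := by
        refine sum_le_sum fun e he => mul_le_mul_of_nonneg_left ?_ (hY e he)
        have h : (range b).filter (fun t => e.1 ≤ t ∧ t < e.2) = Ico e.1 e.2 := by
          ext t
          have := hE e he
          simp only [mem_filter, mem_range, mem_Ico]
          omega
        rw [h, sum_Ico_eq_sub _ (hE e he).1.le, sum_range_sub, sum_range_sub]
        linarith [hstep e he]

/-- Multiplicative weights: if for all nonnegative prices some option keeps the priced load below
the priced budget, then options can be chosen so that all total loads stay near their budgets. -/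
theorem exists_options_sum_exp_le {α ι : Type*} [Fintype α] [Inhabited ι] (Opt : ℕ → ι → Prop)
    (load : ℕ → ι → α → ℝ) (ρ : ℕ → α → ℝ) (s lam : ℝ) (hs : s ≤ 1) (hlam : 0 ≤ lam)
    (h0 : ∀ k o, Opt k o → ∀ a, 0 ≤ load k o a)
    (h1 : ∀ k o, Opt k o → ∀ a, lam * load k o a ≤ s)
    (hopt : ∀ k, ∀ P : α → ℝ, (∀ a, 0 ≤ P a) →
      ∃ o, Opt k o ∧ ∑ a, P a * load k o a ≤ ∑ a, P a * ρ k a) (K : ℕ) :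
    ∃ o : ℕ → ι, (∀ k < K, Opt k (o k)) ∧
      ∑ a, Real.exp (lam * ∑ k ∈ range K, load k (o k) a -
        lam * (1 + s) * ∑ k ∈ range K, ρ k a) ≤ Fintype.card α := by
  induction K with
  | zero => exact ⟨fun _ => default, by simp, by simp⟩
  | succ K ih =>
    obtain ⟨o, ho, hsum⟩ := ih
    set A : α → ℝ := fun a => lam * ∑ k ∈ range K, load k (o k) a -
        lam * (1 + s) * ∑ k ∈ range K, ρ k a with hA
    -- Prices are the current exponential weights with the next budget already deducted, so that `1
    -- + z ≤ exp z` restores the old potential at the end.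
    set P : α → ℝ := fun a => Real.exp (A a - lam * (1 + s) * ρ K a) with hP
    obtain ⟨oK, hoK, hle⟩ := hopt K P fun a => (Real.exp_pos _).le
    have hs0 : ∀ a : α, 0 ≤ s := fun a => (mul_nonneg hlam (h0 K oK hoK a)).trans (h1 K oK hoK a)
    have hcongr : ∀ a, ∑ k ∈ range K, load k (Function.update o K oK k) a =
        ∑ k ∈ range K, load k (o k) a := fun a => sum_congr rfl fun k hk => by
      rw [Function.update_of_ne (mem_range.1 hk).ne]
    refine ⟨Function.update o K oK, ?_, ?_⟩
    · intro k hk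
      rcases Nat.lt_succ_iff_lt_or_eq.1 hk with h | rfl
      · rw [Function.update_of_ne h.ne]; exact ho k h
      · rw [Function.update_self]; exact hoK
    · refine le_trans ?_ hsum
      calc _ = ∑ a, P a * Real.exp (lam * load K oK a) := by
            refine sum_congr rfl fun a _ => ?_
            rw [sum_range_succ, sum_range_succ, hcongr, Function.update_self, hP, ← Real.exp_add]
            congr 1
            simp only [hA]
            ring
        _ ≤ ∑ a, P a * (1 + lam * (1 + s) * load K oK a) := by
            refine sum_le_sum fun a _ => mul_le_mul_of_nonneg_left ?_ (Real.exp_pos _).le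
            have hx0 : 0 ≤ lam * load K oK a := mul_nonneg hlam (h0 K oK hoK a)
            have hxs := h1 K oK hoK a
            -- For `0 ≤ z ≤ s ≤ 1`, `exp z ≤ 1 + z + z ^ 2 ≤ 1 + (1 + s) * z`.
            have := Real.abs_exp_sub_one_sub_id_le (x := lam * load K oK a)
              (abs_le.2 ⟨by linarith, by linarith⟩)
            have := (abs_le.1 this).2
            nlinarith
        _ = ∑ a, P a + lam * (1 + s) * ∑ a, P a * load K oK a := by
            rw [mul_sum, ← sum_add_distrib]
            exact sum_congr rfl fun a _ => by ring
        _ ≤ ∑ a, P a + ∑ a, lam * (1 + s) * (P a * ρ K a) := by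
            rw [← mul_sum]
            rcases isEmpty_or_nonempty α with hα | ⟨⟨a⟩⟩
            · simp
            · have := hs0 a
              gcongr
        _ = ∑ a, P a * (lam * (1 + s) * ρ K a + 1) := by
            rw [← sum_add_distrib]
            exact sum_congr rfl fun a _ => by ring
        _ ≤ ∑ a, P a * Real.exp (lam * (1 + s) * ρ K a) :=
            sum_le_sum fun a _ =>
              mul_le_mul_of_nonneg_left (Real.add_one_le_exp _) (Real.exp_pos _).le
        _ = ∑ a, Real.exp (A a) := by
            refine sum_congr rfl fun a _ => ?_
            rw [hP, ← Real.exp_add]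
            congr 1
            ring

theorem exists_options_load_le {α ι : Type*} [Fintype α] [Inhabited ι] (Opt : ℕ → ι → Prop)
    (load : ℕ → ι → α → ℝ) (ρ : ℕ → α → ℝ) (s lam : ℝ) (hs : s ≤ 1) (hlam : 0 ≤ lam)
    (h0 : ∀ k o, Opt k o → ∀ a, 0 ≤ load k o a)
    (h1 : ∀ k o, Opt k o → ∀ a, lam * load k o a ≤ s)
    (hopt : ∀ k, ∀ P : α → ℝ, (∀ a, 0 ≤ P a) →
      ∃ o, Opt k o ∧ ∑ a, P a * load k o a ≤ ∑ a, P a * ρ k a) (K : ℕ) :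
    ∃ o : ℕ → ι, (∀ k < K, Opt k (o k)) ∧ ∀ a, lam * ∑ k ∈ range K, load k (o k) a ≤
      Real.log (Fintype.card α) + lam * (1 + s) * ∑ k ∈ range K, ρ k a := by
  obtain ⟨o, ho, hsum⟩ := exists_options_sum_exp_le Opt load ρ s lam hs hlam h0 h1 hopt K
  refine ⟨o, ho, fun a => ?_⟩
  have h := (single_le_sum (f := fun a => Real.exp (lam * ∑ k ∈ range K, load k (o k) a -
    lam * (1 + s) * ∑ k ∈ range K, ρ k a)) (fun a _ => (Real.exp_pos _).le) (mem_univ a)).trans hsum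
  rw [← Real.le_log_iff_exp_le (lt_of_lt_of_le (Real.exp_pos _) h)] at h
  linarith

/-- A fractional matching saturating `σ` yields an integral one with the same support. -/
theorem exists_injective_of_fractional_matching {σ α : Type*} [Fintype α] [DecidableEq α]
    (𝒮 : Finset σ) (x : σ → α → ℝ) (hx : ∀ e ∈ 𝒮, ∀ a, 0 ≤ x e a)
    (hrow : ∀ e ∈ 𝒮, ∑ a, x e a = 1) (hcol : ∀ a, ∑ e ∈ 𝒮, x e a ≤ 1) :
    ∃ φ : 𝒮 → α, Function.Injective φ ∧ ∀ e : 𝒮, x e (φ e) ≠ 0 := by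
  classical
  -- Hall's condition: the rows in `A` have mass `#A`, all of it in neighbouring columns that hold
  -- at most 1 each.
  obtain ⟨φ, hφ, hmem⟩ := (Finset.all_card_le_biUnion_card_iff_exists_injective
    fun e : 𝒮 => univ.filter fun a => x e a ≠ 0).1 fun A => by
      have : (A.card : ℝ) ≤ (A.biUnion fun e : 𝒮 => univ.filter fun a => x e a ≠ 0).card := by
        calc (A.card : ℝ) = ∑ e ∈ A, ∑ a, x e a := by
              rw [sum_congr rfl fun e _ => hrow e.1 e.2]; simp
          _ = ∑ e ∈ A, ∑ a ∈ A.biUnion (fun e : 𝒮 => univ.filter fun a => x e a ≠ 0), x e a := by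
              refine sum_congr rfl fun e he => (sum_subset (subset_univ _) fun a _ ha => ?_).symm
              by_contra hne
              exact ha (mem_biUnion.2 ⟨e, he, by simpa using hne⟩)
          _ = ∑ a ∈ A.biUnion (fun e : 𝒮 => univ.filter fun a => x e a ≠ 0), ∑ e ∈ A, x e a :=
              sum_comm
          _ ≤ ∑ a ∈ A.biUnion (fun e : 𝒮 => univ.filter fun a => x e a ≠ 0), (1 : ℝ) := by
              refine sum_le_sum fun a _ => le_trans ?_ (hcol a)
              rw [← sum_coe_sort 𝒮 fun e => x e a]
              exact sum_le_sum_of_subset_of_nonneg (subset_univ _) fun e _ _ => hx e.1 e.2 a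
          _ = _ := by simp
      exact_mod_cast this
  exact ⟨φ, hφ, fun e => (mem_filter.1 (hmem e)).2⟩

/-- If the cells of a word are covered by intervals, and these have distinct letters each of which
is absent from its interval, then some arrangement of these letters is not a subsequence. -/
theorem exists_nodup_not_sublist {α σ : Type*} [DecidableEq α] (T : ℕ) (cell : ℕ → Finset α)
    (v : ℕ → List α) (hvT : v T = [])
    (hv : ∀ t, ∃ u : List α, v t = u ++ v (t + 1) ∧ ∀ a ∈ u, a ∈ cell t)
    (start finish : σ → ℕ) (φ : σ → α) (hφ : Function.Injective φ)
    (habs : ∀ e t, start e ≤ t → t < finish e → φ e ∉ cell t)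
    (hcov : ∀ t < T, ∃ e, start e ≤ t ∧ t < finish e) (hfinish : ∀ e, finish e ≤ T)
    (t : ℕ) (ht : t < T) :
    ∃ l : List α, l.Nodup ∧ (∀ a ∈ l, ∃ e, t < finish e ∧ φ e = a) ∧ ¬ l.Sublist (v t) := by
  have skip : ∀ (a : α) (l : List α) (i d : ℕ), (∀ r, i ≤ r → r < i + d → a ∉ cell r) →
      (a :: l).Sublist (v i) → (a :: l).Sublist (v (i + d)) := by
    intro a l i d
    induction d with
    | zero => exact fun _ h => h
    | succ d ih =>
      intro ha h
      have h₁ := ih (fun r h₁ h₂ => ha r h₁ (by omega)) h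
      obtain ⟨u, hu, hcell⟩ := hv (i + d)
      rw [hu] at h₁
      have hau : a ∉ u := fun hmem => ha (i + d) (by omega) (by omega) (hcell a hmem)
      clear hu hcell
      induction u with
      | nil => exact h₁
      | cons c u ihu =>
        rw [List.cons_append] at h₁
        cases h₁ with
        | cons _ h₁ => exact ihu h₁ fun h => hau (List.mem_cons_of_mem _ h)
        | cons_cons _ h₁ => exact absurd List.mem_cons_self hau
  induction hm : T - t using Nat.strong_induction_on generalizing t with
  | _ m ih =>
  obtain ⟨e, he₁, he₂⟩ := hcov t ht
  obtain ⟨d, hd⟩ : ∃ d, finish e = t + d := ⟨finish e - t, by omega⟩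
  -- The letter `φ e` does not occur before the end of `e`, so an embedding starting with it uses
  -- only later cells.
  have hskip : ∀ l, (φ e :: l).Sublist (v t) → (φ e :: l).Sublist (v (finish e)) := by
    intro l h
    rw [hd]
    exact skip _ _ _ _ (fun r h₁ h₂ => habs e r (by omega) (by omega)) h
  rcases (hfinish e).eq_or_lt with hT | hT
  · refine ⟨[φ e], by simp, by simpa using ⟨e, he₂, rfl⟩, fun h => ?_⟩
    have := hskip [] h
    rw [hT, hvT] at this
    simp at this
  · obtain ⟨l, hl, hle, hnot⟩ := ih (T - finish e) (by omega) (finish e) hT rfl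
    -- Later letters belong to intervals ending strictly after `e`, so injectivity of `φ` excludes a
    -- repetition.
    refine ⟨φ e :: l, List.nodup_cons.2 ⟨fun h => ?_, hl⟩, ?_, fun h => ?_⟩
    · obtain ⟨e', he', heq⟩ := hle _ h
      rw [hφ heq] at he'
      exact lt_irrefl _ he'
    · intro a ha
      rcases List.mem_cons.1 ha with rfl | ha
      · exact ⟨e, he₂, rfl⟩
      · obtain ⟨e', he', heq⟩ := hle a ha
        exact ⟨e', by omega, heq⟩
    · exact hnot ((List.sublist_cons_self _ _).trans (hskip l h))

end Covering

/-! ### Runs avoiding a letter, and covers of windows by heavy runs. -/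

section Windows

open Finset

variable {α : Type*}

/-- `[e.1, e.2)` is a maximal interval of cells in `[0, b)` without the letter `a`. -/
def IsRun (D : ℕ → Finset α) (b : ℕ) (a : α) (e : ℕ × ℕ) : Prop :=
  e.1 < e.2 ∧ e.2 ≤ b ∧ (∀ t, e.1 ≤ t → t < e.2 → a ∉ D t) ∧ (e.1 = 0 ∨ a ∈ D (e.1 - 1)) ∧
    (e.2 = b ∨ a ∈ D e.2)

theorem exists_isRun (D : ℕ → Finset α) {b t : ℕ} {a : α} (ht : t < b) (ha : a ∉ D t) :
    ∃ e, IsRun D b a e ∧ e.1 ≤ t ∧ t < e.2 := by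
  have hi : ∃ i, ∀ r, i ≤ r → r ≤ t → a ∉ D r :=
    ⟨t, fun r h₁ h₂ => le_antisymm h₂ h₁ ▸ ha⟩
  have hj : ∃ j, t < j ∧ (j = b ∨ a ∈ D j) := ⟨b, ht, Or.inl rfl⟩
  classical
  have hit : Nat.find hi ≤ t := Nat.find_min' hi fun r h₁ h₂ => le_antisymm h₂ h₁ ▸ ha
  refine ⟨(Nat.find hi, Nat.find hj), ⟨hit.trans_lt (Nat.find_spec hj).1,
    Nat.find_min' hj ⟨ht, Or.inl rfl⟩, fun r h₁ h₂ => ?_, ?_, (Nat.find_spec hj).2⟩, hit,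
    (Nat.find_spec hj).1⟩
  · rcases le_or_gt r t with h | h
    · exact Nat.find_spec hi r h₁ h
    · exact fun hr => Nat.find_min hj h₂ ⟨h, Or.inr hr⟩
  · by_contra! hcon
    obtain ⟨h0, hmem⟩ := hcon
    refine Nat.find_min hi (Nat.sub_lt (Nat.pos_of_ne_zero h0) one_pos) fun r h₁ h₂ => ?_
    rcases eq_or_ne r (Nat.find hi - 1) with rfl | hne
    · exact hmem
    · exact Nat.find_spec hi r (by simp only at *; omega) h₂

theorem IsRun.snd_le {D : ℕ → Finset α} {b : ℕ} {a : α} {e e' : ℕ × ℕ} (h : IsRun D b a e)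
    (h' : IsRun D b a e') (he : e.1 = e'.1) : e'.2 ≤ e.2 := by
  by_contra! hlt
  rcases h.2.2.2.2 with hb | hmem
  · have := h'.2.1
    omega
  · exact h'.2.2.1 e.2 (he ▸ h.1.le) hlt hmem

/-- The candidate intervals inside a window of `b` cells. -/
def windowIntervals (b : ℕ) : Finset (ℕ × ℕ) := range (b + 1) ×ˢ range (b + 1)

theorem IsRun.mem_windowIntervals {D : ℕ → Finset α} {b : ℕ} {a : α} {e : ℕ × ℕ}
    (h : IsRun D b a e) : e ∈ windowIntervals b := by
  have := h.1
  have := h.2.1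
  simp only [windowIntervals, mem_product, mem_range]
  omega

open Classical in
-- A run is determined by its start, which is 0 or follows a cell containing `a`.
theorem card_isRun_le [DecidableEq α] (D : ℕ → Finset α) (b : ℕ) (a : α) :
    #{e ∈ windowIntervals b | IsRun D b a e} ≤ #{t ∈ range b | a ∈ D t} + 1 := by
  calc #{e ∈ windowIntervals b | IsRun D b a e}
      ≤ #(insert 0 (({t ∈ range b | a ∈ D t}).image Nat.succ)) := by
        refine card_le_card_of_injOn Prod.fst ?_ ?_
        · intro e he
          have h := (mem_filter.1 he).2
          rw [mem_coe, mem_insert, mem_image]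
          rcases Nat.eq_zero_or_pos e.1 with h0 | h0
          · exact Or.inl h0
          · refine Or.inr ⟨e.1 - 1, ?_, Nat.sub_add_cancel h0⟩
            rw [mem_filter, mem_range]
            have := h.1
            have := h.2.1
            exact ⟨by omega, h.2.2.2.1.resolve_left h0.ne'⟩
        · intro e he e' he' heq
          have h := (mem_filter.1 he).2
          have h' := (mem_filter.1 he').2
          exact Prod.ext heq (le_antisymm (h'.snd_le h heq.symm) (h.snd_le h' heq))
    _ ≤ _ := (card_insert_le _ _).trans (Nat.add_le_add_right card_image_le 1)

variable [Fintype α]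

open Classical in
/-- The total weight of the letters that have `e` as a run. -/
noncomputable def runWeight (D : ℕ → Finset α) (b : ℕ) (y : α → ℝ) (e : ℕ × ℕ) : ℝ :=
  ∑ a with IsRun D b a e, y a

open Classical in
/-- The share of the interval `e` carried by the letter `a`. -/
noncomputable def share (D : ℕ → Finset α) (b : ℕ) (y : α → ℝ) (e : ℕ × ℕ) (a : α) : ℝ :=
  if IsRun D b a e then y a / runWeight D b y e else 0

theorem share_nonneg (D : ℕ → Finset α) (b : ℕ) {y : α → ℝ} (hy : ∀ a, 0 ≤ y a) (e : ℕ × ℕ)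
    (a : α) : 0 ≤ share D b y e a := by
  unfold share
  split_ifs
  · exact div_nonneg (hy a) (sum_nonneg fun a _ => hy a)
  · exact le_rfl

theorem isRun_of_share_ne_zero {D : ℕ → Finset α} {b : ℕ} {y : α → ℝ} {e : ℕ × ℕ} {a : α}
    (h : share D b y e a ≠ 0) : IsRun D b a e := by
  by_contra hn
  exact h (if_neg hn)

theorem sum_share (D : ℕ → Finset α) (b : ℕ) (y : α → ℝ) {e : ℕ × ℕ}
    (he : 0 < runWeight D b y e) : ∑ a, share D b y e a = 1 := by
  classical
  unfold share
  rw [← sum_filter, ← sum_div]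
  exact div_self he.ne'

/-- `τ` consists of intervals of weight at least `κ` and covers the window. -/
def IsWindowCover (D : ℕ → Finset α) (b : ℕ) (y : α → ℝ) (κ : ℝ) (τ : Finset (ℕ × ℕ)) : Prop :=
  (∀ e ∈ τ, e ∈ windowIntervals b ∧ e.1 < e.2 ∧ e.2 ≤ b ∧ κ ≤ runWeight D b y e) ∧
    ∀ t < b, ∃ e ∈ τ, e.1 ≤ t ∧ t < e.2

/-- Heaviness bounds each share by `M / κ`. Small individual loads are what multiplicative weights
requires. -/
theorem IsWindowCover.load_le {D : ℕ → Finset α} {b : ℕ} {y : α → ℝ} {κ M : ℝ}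
    {τ : Finset (ℕ × ℕ)} (h : IsWindowCover D b y κ τ) (hκ : 0 < κ) (hy : ∀ a, 0 ≤ y a)
    (hM : ∀ a, y a ≤ M) (a : α) : ∑ e ∈ τ, share D b y e a ≤ (b + 1) ^ 2 * (M / κ) := by
  have hM0 : 0 ≤ M := (hy a).trans (hM a)
  calc ∑ e ∈ τ, share D b y e a ≤ ∑ e ∈ τ, M / κ := by
        refine sum_le_sum fun e he => ?_
        unfold share
        split_ifs
        · exact div_le_div₀ hM0 (hM a) hκ (h.1 e he).2.2.2
        · positivity
    _ = #τ * (M / κ) := by rw [sum_const, nsmul_eq_mul]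
    _ ≤ (b + 1) ^ 2 * (M / κ) := by
        have h₁ : #τ ≤ #(windowIntervals b) := card_le_card fun e he => (h.1 e he).1
        have h₂ : #(windowIntervals b) = (b + 1) ^ 2 := by
          simp [windowIntervals, pow_two]
        rw [h₂] at h₁
        have h₃ : (#τ : ℝ) ≤ (b + 1) ^ 2 := by exact_mod_cast h₁
        gcongr

open Classical in
-- The run weights cover every cell fractionally; dropping the light intervals loses at most `(b +
-- 1) ^ 2 * κ`. In the cost of the fractional cover, the run weight cancels the denominator of the
-- share, leaving `y a` per run of `a`.
theorem exists_isWindowCover [DecidableEq α] (D : ℕ → Finset α) (b : ℕ) (y : α → ℝ) (κ q : ℝ) (hκ : 0 < κ)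
    (hq : 0 < q) (hy : ∀ a, 0 ≤ y a)
    (hcov : ∀ t < b, q + (b + 1) ^ 2 * κ ≤ ∑ a with a ∉ D t, y a) (P : α → ℝ)
    (hP : ∀ a, 0 ≤ P a) :
    ∃ τ, IsWindowCover D b y κ τ ∧ ∑ a, P a * ∑ e ∈ τ, share D b y e a ≤
      ∑ a, P a * (#{e ∈ windowIntervals b | IsRun D b a e} * y a / q) := by
  set W := (windowIntervals b).filter fun e => e.1 < e.2 ∧ e.2 ≤ b with hW
  set E := W.filter fun e => κ ≤ runWeight D b y e with hE
  set c : ℕ × ℕ → ℝ := fun e => ∑ a, P a * share D b y e a with hc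
  have hYpos : ∀ e ∈ E, 0 < runWeight D b y e := fun e he => hκ.trans_le (mem_filter.1 he).2
  obtain ⟨τ, hτE, hτcov, hτ⟩ := exists_cover_cost_le b E (runWeight D b y) c q hq
    (fun e he => (mem_filter.1 (mem_filter.1 he).1).2)
    (fun e _ => sum_nonneg fun a _ => mul_nonneg (hP a) (share_nonneg D b hy e a))
    (fun e he => (hYpos e he).le) (by
      intro t ht
      have h₁ : ∑ a with a ∉ D t, y a ≤
          ∑ e ∈ W with e.1 ≤ t ∧ t < e.2, runWeight D b y e := by
        calc ∑ a with a ∉ D t, y a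
            ≤ ∑ a, ∑ e ∈ W with e.1 ≤ t ∧ t < e.2, if IsRun D b a e then y a else 0 := by
              rw [sum_filter]
              refine sum_le_sum fun a _ => ?_
              have hnn : ∀ e ∈ W.filter (fun e => e.1 ≤ t ∧ t < e.2),
                  0 ≤ if IsRun D b a e then y a else 0 := fun e _ => by
                split_ifs
                · exact hy a
                · exact le_rfl
              by_cases ha : a ∉ D t
              · rw [if_pos ha]
                obtain ⟨e, he, het⟩ := exists_isRun D ht ha
                have hmem : e ∈ W.filter (fun e => e.1 ≤ t ∧ t < e.2) :=
                  mem_filter.2 ⟨mem_filter.2 ⟨he.mem_windowIntervals, he.1, he.2.1⟩, het⟩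
                have := single_le_sum hnn hmem
                rwa [if_pos he] at this
              · rw [if_neg ha]
                exact sum_nonneg hnn
          _ = _ := by
              rw [sum_comm]
              refine sum_congr rfl fun e _ => ?_
              rw [runWeight, sum_filter]
      have h₂ : ∑ e ∈ W with e.1 ≤ t ∧ t < e.2, runWeight D b y e ≤
          ∑ e ∈ E with e.1 ≤ t ∧ t < e.2, runWeight D b y e + (b + 1) ^ 2 * κ := by
        rw [← sum_filter_add_sum_filter_not (W.filter fun e => e.1 ≤ t ∧ t < e.2)
          (fun e => κ ≤ runWeight D b y e)]
        refine add_le_add (le_of_eq ?_) ?_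
        · rw [hE, filter_comm]
        · refine (sum_le_card_nsmul _ _ κ fun e he => (not_le.1 (mem_filter.1 he).2).le).trans ?_
          rw [nsmul_eq_mul]
          have h₃ : #((W.filter fun e => e.1 ≤ t ∧ t < e.2).filter
              fun e => ¬ κ ≤ runWeight D b y e) ≤ (b + 1) ^ 2 := by
            refine (card_le_card ((filter_subset _ _).trans
              ((filter_subset _ _).trans (filter_subset _ _)))).trans ?_
            simp [windowIntervals, pow_two]
          have h₄ : ((#((W.filter fun e => e.1 ≤ t ∧ t < e.2).filter
              fun e => ¬ κ ≤ runWeight D b y e) : ℕ) : ℝ) ≤ (b + 1) ^ 2 := by exact_mod_cast h₃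
          gcongr
      linarith [hcov t ht])
  refine ⟨τ, ⟨fun e he => ?_, hτcov⟩, ?_⟩
  · have h := mem_filter.1 (hτE he)
    have h' := mem_filter.1 h.1
    exact ⟨h'.1, h'.2.1, h'.2.2, h.2⟩
  · have hcost : ∑ a, P a * ∑ e ∈ τ, share D b y e a = ∑ e ∈ τ, c e := by
      simp_rw [hc, mul_sum]
      exact sum_comm
    have hbudget : ∑ e ∈ E, runWeight D b y e * c e ≤
        ∑ a, P a * (#{e ∈ windowIntervals b | IsRun D b a e} * y a) := by
      calc ∑ e ∈ E, runWeight D b y e * c e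
          = ∑ a, ∑ e ∈ E, P a * (if IsRun D b a e then y a else 0) := by
            rw [sum_comm]
            refine sum_congr rfl fun e he => ?_
            rw [hc, mul_sum]
            refine sum_congr rfl fun a _ => ?_
            have := (hYpos e he).ne'
            unfold share
            split_ifs
            · field_simp
            · simp
        _ ≤ ∑ a, ∑ e ∈ windowIntervals b, P a * (if IsRun D b a e then y a else 0) := by
            refine sum_le_sum fun a _ => sum_le_sum_of_subset_of_nonneg
              ((filter_subset _ _).trans (filter_subset _ _)) fun e _ _ => mul_nonneg (hP a) ?_
            split_ifs
            · exact hy a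
            · exact le_rfl
        _ = _ := by
            refine sum_congr rfl fun a _ => ?_
            rw [← mul_sum, ← sum_filter, sum_const, nsmul_eq_mul]
    rw [hcost]
    have h : ∑ a, P a * (#{e ∈ windowIntervals b | IsRun D b a e} * y a / q) =
        (∑ a, P a * (#{e ∈ windowIntervals b | IsRun D b a e} * y a)) / q := by
      rw [sum_div]
      exact sum_congr rfl fun a _ => by ring
    rw [h, le_div_iff₀ hq, mul_comm]
    exact hτ.trans hbudget

/-- A word over `α` of length at most `K * b * h` misses some arrangement of distinct letters, when
the parameters satisfy the stated inequalities. -/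
theorem exists_nodup_not_sublist_of_length_le [DecidableEq α] [Nonempty α] (w : List α) (K b h : ℕ)
    (κ q s lam : ℝ) (hK : 0 < K) (hb : 0 < b) (hw : w.length ≤ K * b * h) (hκ : 0 < κ)
    (hq : 0 < q) (hs : s ≤ 1) (hlam : 0 < lam)
    (hcov : q + h / K + (b + 1) ^ 2 * κ ≤
      (Fintype.card α : ℝ) ^ 2 / (K * b * h + Fintype.card α * K))
    (hload : lam * ((b + 1) ^ 2 * (1 / K / κ)) ≤ s)
    (hlog : Real.log (Fintype.card α) + lam * (1 + s) / q ≤ lam) :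
    ∃ l : List α, l.Nodup ∧ ¬ l.Sublist w := by
  classical
  set cell : ℕ → Finset α := fun t => ((w.drop (t * h)).take h).toFinset with hcell
  have hcell_card : ∀ t, #(cell t) ≤ h := fun t =>
    (List.toFinset_card_le _).trans (List.length_take_le _ _)
  set D : ℕ → ℕ → Finset α := fun k t => cell (k * b + t) with hD
  set occ : α → ℕ := fun a => ∑ k ∈ range K, #{t ∈ range b | a ∈ D k t} with hocc
  -- Over all windows `a` has at most `occ a + K` runs, so their total weight is at most 1.
  set y : α → ℝ := fun a => 1 / (occ a + K) with hydef
  have hKR : (0 : ℝ) < K := by exact_mod_cast hK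
  have hz : ∀ a, (0 : ℝ) < occ a + K := fun a =>
    add_pos_of_nonneg_of_pos (Nat.cast_nonneg _) hKR
  have hy : ∀ a, 0 ≤ y a := fun a => one_div_nonneg.2 (hz a).le
  have hyK : ∀ a, y a ≤ 1 / K := fun a =>
    one_div_le_one_div_of_le hKR (le_add_of_nonneg_left (Nat.cast_nonneg _))
  have hocc_sum : ∑ a, occ a ≤ K * b * h := by
    calc ∑ a, occ a = ∑ k ∈ range K, ∑ t ∈ range b, #(D k t) := by
          rw [hocc, sum_comm]
          refine sum_congr rfl fun k _ => ?_
          simp_rw [card_filter]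
          rw [sum_comm]
          refine sum_congr rfl fun t _ => ?_
          rw [← card_filter, filter_univ_mem]
      _ ≤ ∑ k ∈ range K, ∑ t ∈ range b, h :=
          sum_le_sum fun k _ => sum_le_sum fun t _ => hcell_card _
      _ = K * b * h := by simp [mul_assoc]
  have hy_sum : (Fintype.card α : ℝ) ^ 2 / (K * b * h + Fintype.card α * K) ≤ ∑ a, y a := by
    -- Cauchy–Schwarz bounds the sum of reciprocals below.
    have h₁ := sq_sum_div_le_sum_sq_div univ (fun _ : α => (1 : ℝ)) fun a _ => hz a
    have h₂ : ∑ a, ((occ a : ℝ) + K) ≤ K * b * h + Fintype.card α * K := by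
      rw [sum_add_distrib, sum_const, nsmul_eq_mul, card_univ]
      gcongr
      exact_mod_cast hocc_sum
    have h₃ : 0 < ∑ a, ((occ a : ℝ) + K) := sum_pos (fun a _ => hz a) univ_nonempty
    simp only [sum_const, nsmul_eq_mul, mul_one, card_univ, one_pow] at h₁
    exact (div_le_div_of_nonneg_left (by positivity) h₃ h₂).trans h₁
  have hcov' : ∀ k, ∀ t < b, q + (b + 1) ^ 2 * κ ≤ ∑ a with a ∉ D k t, y a := by
    intro k t _
    have h₁ := sum_filter_add_sum_filter_not univ (fun a => a ∈ D k t) y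
    have h₂ : ∑ a with a ∈ D k t, y a ≤ h / K := by
      rw [filter_univ_mem]
      calc ∑ a ∈ D k t, y a ≤ #(D k t) * (1 / K : ℝ) := by
            simpa using sum_le_card_nsmul (D k t) y (1 / K) fun a _ => hyK a
        _ ≤ h * (1 / K : ℝ) := by
            have : (#(D k t) : ℝ) ≤ h := by exact_mod_cast hcell_card _
            gcongr
        _ = h / K := by ring
    linarith
  obtain ⟨τ, hτ, hτload⟩ := exists_options_load_le
    (fun k τ => IsWindowCover (D k) b y κ τ) (fun k τ a => ∑ e ∈ τ, share (D k) b y e a)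
    (fun k a => #{e ∈ windowIntervals b | IsRun (D k) b a e} * y a / q) s lam hs hlam.le
    (fun k τ _ a => sum_nonneg fun e _ => share_nonneg _ _ hy e a)
    (fun k τ hτ a => (mul_le_mul_of_nonneg_left (hτ.load_le hκ hy hyK a) hlam.le).trans hload)
    (fun k P hP => exists_isWindowCover (D k) b y κ q hκ hq hy (hcov' k) P hP) K
  have hs0 : 0 ≤ s := le_trans (by positivity) hload
  have hload1 : ∀ a, ∑ k ∈ range K, ∑ e ∈ τ k, share (D k) b y e a ≤ 1 := by
    intro a
    have h₁ : ∑ k ∈ range K, (#{e ∈ windowIntervals b | IsRun (D k) b a e} * y a / q : ℝ)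
        ≤ 1 / q := by
      rw [← sum_div, ← sum_mul]
      refine div_le_div_of_nonneg_right ?_ hq.le
      have h₂ : ∑ k ∈ range K, (#{e ∈ windowIntervals b | IsRun (D k) b a e} : ℝ)
          ≤ occ a + K := by
        have : ∑ k ∈ range K, #{e ∈ windowIntervals b | IsRun (D k) b a e} ≤ occ a + K := by
          refine (sum_le_sum fun k _ => card_isRun_le (D k) b a).trans ?_
          rw [sum_add_distrib]
          simp [hocc]
        exact_mod_cast this
      calc _ ≤ (occ a + K) * y a := mul_le_mul_of_nonneg_right h₂ (hy a)
        _ = 1 := by rw [hydef]; exact mul_one_div_cancel (hz a).ne'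
    have h₂ := hτload a
    have h₃ : lam * (1 + s) * ∑ k ∈ range K,
        (#{e ∈ windowIntervals b | IsRun (D k) b a e} * y a / q : ℝ) ≤ lam * (1 + s) / q := by
      calc _ ≤ lam * (1 + s) * (1 / q) := by gcongr
        _ = _ := by ring
    -- The slack gained from `q` in `hlog` absorbs both the logarithm and the factor `1 + s`.
    have h₄ : lam * ∑ k ∈ range K, ∑ e ∈ τ k, share (D k) b y e a ≤ lam * 1 := by linarith
    exact le_of_mul_le_mul_left h₄ hlam
  set 𝒮 : Finset (Σ _ : ℕ, ℕ × ℕ) := (range K).sigma τ with h𝒮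
  have h𝒮mem : ∀ e ∈ 𝒮, e.1 < K ∧ e.2 ∈ τ e.1 := fun e he => by
    simpa [h𝒮] using he
  obtain ⟨φ, hφ, hφrun⟩ := exists_injective_of_fractional_matching 𝒮
    (fun e a => share (D e.1) b y e.2 a) (fun e _ a => share_nonneg _ _ hy _ _)
    (fun e he => sum_share _ _ _
      (hκ.trans_le ((hτ e.1 (h𝒮mem e he).1).1 e.2 (h𝒮mem e he).2).2.2.2))
    (fun a => by rw [h𝒮, sum_sigma]; exact hload1 a)
  obtain ⟨l, hl, -, hnot⟩ := exists_nodup_not_sublist (K * b) cell (fun t => w.drop (t * h))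
    (List.drop_of_length_le hw)
    (fun t => ⟨(w.drop (t * h)).take h, by
      rw [Nat.succ_mul, ← List.drop_drop, List.take_append_drop], fun a ha =>
        List.mem_toFinset.2 ha⟩)
    (fun e : 𝒮 => e.1.1 * b + e.1.2.1) (fun e => e.1.1 * b + e.1.2.2) φ hφ
    (by
      intro e t h₁ h₂
      have := (isRun_of_share_ne_zero (hφrun e)).2.2.1 (t - e.1.1 * b) (by omega) (by omega)
      simp only [hD] at this
      rwa [Nat.add_sub_cancel' (by omega)] at this)
    (by
      intro t ht
      have hk : t / b < K := Nat.div_lt_of_lt_mul (by rwa [mul_comm])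
      obtain ⟨e, he, h₁, h₂⟩ := (hτ _ hk).2 (t % b) (Nat.mod_lt _ hb)
      refine ⟨⟨⟨t / b, e⟩, by simp [h𝒮, hk, he]⟩, ?_⟩
      have := Nat.div_add_mod' t b
      simp only
      omega)
    (by
      intro e
      have h₁ := h𝒮mem e.1 e.2
      have h₂ := ((hτ _ h₁.1).1 _ h₁.2).2.2.1
      have h₃ : (e.1.1 + 1) * b ≤ K * b := Nat.mul_le_mul_right b h₁.1
      rw [Nat.succ_mul] at h₃
      omega)
    0 (Nat.mul_pos hK hb)
  exact ⟨l, hl, by simpa using hnot⟩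

end Windows

/-! ### Choice of parameters and the asymptotic lower bound. -/

namespace BooleanNetwork

/-- In the denominator the first term is about `(1 - x) * n ^ 2` and the second at most about `n ^ 2
/ N`, so the quotient is at least `1 + 0.98 * x`. The other terms on the left cost at most `3 / N ^
2 ≤ 0.03 * x`. -/
theorem coverage_le {x N n K h : ℝ} (hx0 : 0 < x) (hx1 : x ≤ 1 / 2) (hNpos : 0 < N)
    (hN : 100 ≤ x * N) (hn2 : 2 ≤ n) (hn : N * (N + 1) ≤ n) (hK₁ : (1 - x) / N * n ≤ K)
    (hK₂ : K ≤ (1 - x) / N * n + 1) (hh0 : 0 ≤ h) (hh : h * N ^ 3 ≤ n) :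
    1 + x / 2 + h / K + 1 / N ^ 2 ≤ n ^ 2 / (K * N ^ 4 * h + n * K) := by
  set c : ℝ := (1 - x) / N with hc
  have hc0 : 0 < c := div_pos (by linarith) hNpos
  have hcN : c * N = 1 - x := div_mul_cancel₀ _ hNpos.ne'
  have hKpos : 0 < K := lt_of_lt_of_le (by positivity) hK₁
  have hden : K * N ^ 4 * h + n * K ≤ n ^ 2 * (1 - x + 2 / N) := by
    have h₁ : K * N ^ 4 * h ≤ (c * n + 1) * (N * n) := by
      calc K * N ^ 4 * h = K * (N * (h * N ^ 3)) := by ring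
        _ ≤ (c * n + 1) * (N * n) := by gcongr
    have h₂ : n * K ≤ n * (n / N + 1) := by
      have : c ≤ 1 / N := div_le_div_of_nonneg_right (by linarith) hNpos.le
      calc n * K ≤ n * (c * n + 1) := by gcongr
        _ ≤ n * (1 / N * n + 1) := by gcongr
        _ = _ := by ring
    have h₃ : (c * n + 1) * (N * n) = (1 - x) * n ^ 2 + N * n := by rw [← hcN]; ring
    have h₄ : (N + 1) * n ≤ n ^ 2 / N := by
      rw [le_div_iff₀ hNpos]
      nlinarith
    have h₅ : n ^ 2 * (1 - x + 2 / N) = (1 - x) * n ^ 2 + n ^ 2 / N + n ^ 2 / N := by ring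
    have h₆ : n * (n / N + 1) = n ^ 2 / N + n := by ring
    linarith
  have hNinv : 2 / N ≤ x / 50 := by
    rw [div_le_div_iff₀ hNpos (by norm_num)]
    linarith
  have hNsq : 1 / N ^ 2 ≤ x / 100 := by
    have h₁ : 1 ≤ N := by nlinarith
    rw [div_le_div_iff₀ (by positivity) (by norm_num)]
    calc (1 : ℝ) * 100 ≤ x * N := by linarith
      _ ≤ x * N ^ 2 := by
        refine mul_le_mul_of_nonneg_left ?_ hx0.le
        exact le_self_pow₀ h₁ two_ne_zero
  have h₁ : h / K ≤ 2 * (1 / N ^ 2) := by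
    rw [mul_one_div, div_le_div_iff₀ hKpos (by positivity)]
    have h₁ : (1 - x) * (h * N ^ 2) ≤ K := by
      calc (1 - x) * (h * N ^ 2) = c * (h * N ^ 3) := by rw [← hcN]; ring
        _ ≤ c * n := by gcongr
        _ ≤ K := hK₁
    have h₂ : 1 / 2 * (h * N ^ 2) ≤ (1 - x) * (h * N ^ 2) :=
      mul_le_mul_of_nonneg_right (by linarith) (by positivity)
    linarith
  have h₂ : 1 + x * (49 / 50) ≤ n ^ 2 / (K * N ^ 4 * h + n * K) := by
    have hpos : 0 < K * N ^ 4 * h + n * K := by positivity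
    rw [le_div_iff₀ hpos]
    calc (1 + x * (49 / 50)) * (K * N ^ 4 * h + n * K)
        ≤ (1 + x * (49 / 50)) * (n ^ 2 * (1 - x * (49 / 50))) := by
          refine mul_le_mul_of_nonneg_left (hden.trans ?_) (by positivity)
          exact mul_le_mul_of_nonneg_left (by linarith) (sq_nonneg n)
      _ = n ^ 2 - (49 / 50) ^ 2 * (x * n) ^ 2 := by ring
      _ ≤ n ^ 2 := sub_le_self _ (by positivity)
  linarith

theorem IsComplete.lt_length {n N : ℕ} {x s : ℝ} (hx0 : 0 < x) (hx1 : x ≤ 1 / 2)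
    (hN : 100 ≤ x * N) (hs : s = x / 6) (hn2 : 2 ≤ n) (hn₁ : ((N : ℝ) * (N + 1)) ≤ n)
    (hn₂ : (N : ℝ) ^ 3 ≤ x * n)
    (hlog : Real.log n * ((((N : ℝ) ^ 4 + 1) ^ 2) ^ 2 * N ^ 3) ≤ s ^ 2 * (1 - x) * n)
    {w : List (Fin n)} (hw : IsComplete w) : (1 - 2 * x) * (n : ℝ) ^ 2 < w.length := by
  by_contra! hlen
  have hNpos : (0 : ℝ) < N := by
    by_contra! h
    nlinarith
  have hnR : (2 : ℝ) ≤ n := by exact_mod_cast hn2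
  have hN0 : N ≠ 0 := by rintro rfl; simp at hNpos
  have hlogn : 0 < Real.log n := Real.log_pos (by linarith)
  have : Nonempty (Fin n) := ⟨⟨0, by omega⟩⟩
  have hs0 : 0 < s := by linarith
  set c : ℝ := (1 - x) / N with hc
  have hc0 : 0 < c := div_pos (by linarith) hNpos
  have hcN : c * N = 1 - x := div_mul_cancel₀ _ hNpos.ne'
  -- There are `K` windows of `N ^ 4` cells of `h` letters. The window size stays fixed while `K`
  -- grows linearly in `n`, so the loads can beat `log n`.
  set K : ℕ := ⌈c * n⌉₊ with hK
  set h : ℕ := n / N ^ 3 with hh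
  have hK₁ : c * n ≤ K := Nat.le_ceil _
  have hK₂ : (K : ℝ) ≤ c * n + 1 := (Nat.ceil_lt_add_one (by positivity)).le
  have hKpos : (0 : ℝ) < K := lt_of_lt_of_le (by positivity) hK₁
  have hh₁ : (h : ℝ) * N ^ 3 ≤ n := by
    have := Nat.div_mul_le_self n (N ^ 3)
    exact_mod_cast this
  have hh₂ : (n : ℝ) ≤ h * N ^ 3 + N ^ 3 := by
    have h₁ := Nat.div_add_mod' n (N ^ 3)
    rw [← hh] at h₁
    have h₂ := Nat.mod_lt n (Nat.pos_of_ne_zero (pow_ne_zero 3 hN0))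
    have : n ≤ h * N ^ 3 + N ^ 3 := by omega
    exact_mod_cast this
  set B : ℝ := ((N : ℝ) ^ 4 + 1) ^ 2 with hB
  have hBpos : 0 < B := by positivity
  have hprod : (w.length : ℝ) ≤ K * N ^ 4 * h := by
    have h₁ : (1 - x) * (n - N ^ 3) ≤ (1 - x) * (h * N ^ 3) :=
      mul_le_mul_of_nonneg_left (by linarith) (by linarith)
    calc (w.length : ℝ) ≤ (1 - 2 * x) * (n : ℝ) ^ 2 := hlen
      _ ≤ n * ((1 - x) * (n - N ^ 3)) := by nlinarith [pow_pos hNpos 3]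
      _ ≤ n * ((1 - x) * (h * N ^ 3)) := by gcongr
      _ = (c * n) * N ^ 4 * h := by rw [← hcN]; ring
      _ ≤ K * N ^ 4 * h := by gcongr
  have hcov : 1 + x / 2 + (h : ℝ) / K + B * (1 / (N ^ 2 * B)) ≤
      (n : ℝ) ^ 2 / (K * N ^ 4 * h + n * K) := by
    have h₁ : B * (1 / (N ^ 2 * B)) = 1 / (N : ℝ) ^ 2 := by field_simp
    rw [h₁]
    exact coverage_le hx0 hx1 hNpos hN hnR hn₁ hK₁ hK₂ (Nat.cast_nonneg h) hh₁
  -- Here `κ` makes the light intervals cost exactly `1 / N ^ 2`, and `s = x / 6` gives `(1 + s) / q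
  -- ≤ 1 - s`, whose slack times `lam = log n / s` pays for `log n`.
  obtain ⟨l, hl, hnot⟩ := exists_nodup_not_sublist_of_length_le w K (N ^ 4) h
    (1 / (N ^ 2 * B)) (1 + x / 2) s (Real.log n / s) (by exact_mod_cast hKpos) (by positivity)
    (by exact_mod_cast hprod) (by positivity) (by positivity) (by linarith) (by positivity)
    (by simpa only [Fintype.card_fin, Nat.cast_pow] using hcov)
    (by
      rw [Nat.cast_pow, ← hB]
      have h₁ : Real.log n / s * (B * (1 / K / (1 / (N ^ 2 * B)))) =
          Real.log n * (B ^ 2 * N ^ 2) / (s * K) := by field_simp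
      rw [h₁, div_le_iff₀ (by positivity)]
      have h₂ : s ^ 2 * (1 - x) * n ≤ s ^ 2 * (N * K) := by
        rw [mul_assoc]
        refine mul_le_mul_of_nonneg_left ?_ (by positivity)
        calc (1 - x) * n = N * (c * n) := by rw [← hcN]; ring
          _ ≤ N * K := by gcongr
      have h₃ : N * (Real.log n * (B ^ 2 * N ^ 2)) ≤ N * (s * (s * K)) := by
        calc N * (Real.log n * (B ^ 2 * N ^ 2)) = Real.log n * (B ^ 2 * N ^ 3) := by ring
          _ ≤ s ^ 2 * (N * K) := hlog.trans h₂
          _ = _ := by ring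
      exact le_of_mul_le_mul_left h₃ hNpos)
    (by
      rw [Fintype.card_fin]
      have h₁ : (1 + s) / (1 + x / 2) ≤ 1 - s := by
        rw [div_le_iff₀ (by positivity)]
        nlinarith
      have h₂ : Real.log n = Real.log n / s * s := (div_mul_cancel₀ _ hs0.ne').symm
      have h₃ : 0 < Real.log n / s := by positivity
      rw [mul_div_assoc]
      nlinarith)
  exact hnot (hw.sublist_of_nodup hl)

theorem eventually_lt_length_of_isComplete {δ : ℝ} (hδ0 : 0 < δ) (hδ1 : δ ≤ 1) :
    ∀ᶠ n : ℕ in Filter.atTop, ∀ w : List (Fin n), IsComplete w →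
      (1 - δ) * (n : ℝ) ^ 2 < w.length := by
  -- The parameter `x` is `δ / 2`; `N` is fixed before `n` grows.
  obtain ⟨N, hN⟩ := exists_nat_ge (100 / (δ / 2))
  rw [div_le_iff₀ (by positivity), mul_comm] at hN
  have hNpos : (0 : ℝ) < N := by
    by_contra! h
    nlinarith
  set C : ℝ := (((N : ℝ) ^ 4 + 1) ^ 2) ^ 2 * N ^ 3 with hC
  have hCpos : 0 < C := by positivity
  have hεpos : 0 < (δ / 2 / 6) ^ 2 * (1 - δ / 2) / C :=
    div_pos (mul_pos (by positivity) (by linarith)) hCpos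
  have hlog := (Real.isLittleO_log_id_atTop.comp_tendsto tendsto_natCast_atTop_atTop).bound hεpos
  have hlarge : ∀ r : ℝ, ∀ᶠ n : ℕ in Filter.atTop, r ≤ n := fun r =>
    tendsto_natCast_atTop_atTop.eventually_ge_atTop r
  filter_upwards [hlog, hlarge (N * (N + 1)), hlarge ((N : ℝ) ^ 3 / (δ / 2)),
    Filter.eventually_ge_atTop 2] with n h₁ h₂ h₃ h₄ w hw
  have h₅ : Real.log n * C ≤ (δ / 2 / 6) ^ 2 * (1 - δ / 2) * n := by
    simp only [Function.comp_apply, id_eq, Real.norm_eq_abs, Nat.abs_cast] at h₁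
    have := (le_abs_self _).trans h₁
    rwa [div_mul_eq_mul_div, le_div_iff₀ hCpos] at this
  have := hw.lt_length (x := δ / 2) (by positivity) (by linarith) hN rfl h₄ h₂
    (by rwa [div_le_iff₀ (by positivity), mul_comm] at h₃) h₅
  rwa [mul_div_cancel₀ δ two_ne_zero] at this

theorem isLittleO_sq_sub_ellPlus :
    Asymptotics.IsLittleO Filter.atTop
      (fun n : ℕ => (n : ℝ) ^ 2 - (ellPlus n : ℝ)) (fun n : ℕ => (n : ℝ) ^ 2) := by
  rw [Asymptotics.isLittleO_iff]
  intro ε hε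
  filter_upwards [eventually_lt_length_of_isComplete (lt_min hε one_pos) (min_le_right ε 1)]
    with n hn
  obtain ⟨w, hlen, hw⟩ := (isLeast_ellPlus n).1
  have h₁ := hn w (synchronizesSet_iff_isComplete.1 hw)
  have h₂ : (ellPlus n : ℝ) ≤ (n : ℝ) ^ 2 := by exact_mod_cast ellPlus_le n
  rw [hlen] at h₁
  rw [Real.norm_of_nonneg (by linarith), Real.norm_of_nonneg (by positivity)]
  have h₃ : min ε 1 * (n : ℝ) ^ 2 ≤ ε * (n : ℝ) ^ 2 := by
    gcongr
    exact min_le_left _ _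
  linarith

end BooleanNetwork

theorem proposition6 :
    -- the words synchronizing all of `F⁺(n)` are exactly the `n`-complete words
    (∀ (n : ℕ) (w : List (Fin n)),
      BooleanNetwork.SynchronizesSet w (BooleanNetwork.FPlus n) ↔ BooleanNetwork.IsComplete w) ∧
    -- the minimum `ℓ⁺(n)` is attained, so it is a genuine minimum
    (∀ n : ℕ, IsLeast (BooleanNetwork.syncLengths n) (BooleanNetwork.ellPlus n)) ∧
    -- `ℓ⁺(n) = n² - o(n²)`
    Asymptotics.IsLittleO Filter.atTop
      (fun n : ℕ => (n : ℝ) ^ 2 - (BooleanNetwork.ellPlus n : ℝ))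
      (fun n : ℕ => (n : ℝ) ^ 2) := by
  exact ⟨fun _ _ => BooleanNetwork.synchronizesSet_iff_isComplete, BooleanNetwork.isLeast_ellPlus,
    BooleanNetwork.isLittleO_sq_sub_ellPlus⟩
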